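/- Let $d\ge 1$ be an integer, $\alpha\in(0,2)$, $\beta>0$ and $\mu,\nu\in(-1,1]$ with $\alpha/2<|\mu-\nu|<2-\alpha/2$. Let $E_\alpha(z)=\sum_{k\ge 0} z^k/\Gamma(\alpha k+1)$ be the Mittag-Leffler function and, for $t>0$, let $$V_{\alpha,\mu,\nu}(t,x)=\int_{\mathbb{R}^d}e^{2\pi i x\cdot\xi}\,E_\alpha\big(e^{(\nu-\mu)\pi i}\,t^{\alpha}|\xi|^{\beta}\big)\,d\xi ,$$ where the integral is understood as the inverse Fourier transform in the sense of tempered distributions. This distribution is given by a locally integrable function on $\mathbb{R}^d$. For $f\in L^p(\mathbb{R}^d)$ put $v(t,\cdot)=V_{\alpha,\mu,\nu}(t,\cdot)*f$; this is the explicit solution formula for the homogeneous Cauchy problem $e^{i\pi\mu}\partial_t^\alpha v=e^{i\pi\nu}(-\Delta)^{\beta/2}v$, $v(0)=f$ ($\partial_t^\alpha$ being the Caputo derivative), and it is taken here as the definition of $v$. For all $1\le p<q\le\infty$ with $\frac1p-\frac1q<\frac{\beta}{d}$ there is a constant $C$, depending only on $d,\alpha,\beta,\mu,\nu,p,q$,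 such that for all $t>0$ and all $f\in L^p(\mathbb{R}^d)$ the convolution integral defining $v(t,\cdot)$ converges absolutely almost everywhere, $v(t,\cdot)\in L^q(\mathbb{R}^d)$, and $$\|v(t,\cdot)\|_{L^q(\mathbb{R}^d)}\le C\,t^{-\frac{\alpha}{\beta}d\left(\frac1p-\frac1q\right)}\,\|f\|_{L^p(\mathbb{R}^d)} .$$ -/

import Mathlib

open MeasureTheory
open scoped FourierTransform SchwartzMap ENNReal NNReal

/-- The one-parameter Mittag-Leffler function
`E_α(z) = ∑_{k ≥ 0} z ^ k / Γ(α k + 1)` (an everywhere convergent series for `α > 0`). -/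
noncomputable def mittagLeffler (α : ℝ) (z : ℂ) : ℂ :=
  ∑' k : ℕ, z ^ k / Complex.Gamma ((α * k + 1 : ℝ) : ℂ)

/-- The Fourier symbol `ξ ↦ E_α(e^{(ν - μ) π i} t ^ α |ξ| ^ β)` on `ℝ^d`, at time `t`. -/
noncomputable def solutionSymbol {d : ℕ} (α β μ ν t : ℝ) (ξ : EuclideanSpace ℝ (Fin d)) : ℂ :=
  mittagLeffler α
    (Complex.exp (((ν - μ) * Real.pi : ℝ) * Complex.I) * ((t ^ α * ‖ξ‖ ^ β : ℝ) : ℂ))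

/-- The function `K` is the inverse Fourier transform
`x ↦ ∫ e^{2 π i ⟪x, ξ⟫} m(ξ) dξ` of `m` in the sense of tempered distributions: `m` and `K` both
act on Schwartz functions by integration, `K` is locally integrable, and
`⟨K, φ⟩ = ⟨m, 𝓕⁻ φ⟩` for all Schwartz functions `φ`. -/
structure IsInverseFourier {d : ℕ} (m K : EuclideanSpace ℝ (Fin d) → ℂ) : Prop where
  integrable_symbol : ∀ φ : 𝓢(EuclideanSpace ℝ (Fin d), ℂ), Integrable (fun ξ => m ξ * φ ξ)
  locallyIntegrable : LocallyIntegrable K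
  integrable_kernel : ∀ φ : 𝓢(EuclideanSpace ℝ (Fin d), ℂ), Integrable (fun x => K x * φ x)
  pairing : ∀ φ : 𝓢(EuclideanSpace ℝ (Fin d), ℂ),
    ∫ x, K x * φ x = ∫ ξ, m ξ * (𝓕⁻ φ) ξ

/-- The convolution `(K ∗ f)(x) = ∫ K(y) f(x - y) dy` of complex functions on `ℝ^d`. -/
noncomputable def conv {d : ℕ} (K f : EuclideanSpace ℝ (Fin d) → ℂ) :
    EuclideanSpace ℝ (Fin d) → ℂ :=
  convolution K f (ContinuousLinearMap.mul ℂ ℂ) volume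

/-- The integral defining `(K ∗ f)(x)` converges absolutely. -/
def ConvExistsAt {d : ℕ} (K f : EuclideanSpace ℝ (Fin d) → ℂ)
    (x : EuclideanSpace ℝ (Fin d)) : Prop :=
  ConvolutionExistsAt K f x (ContinuousLinearMap.mul ℂ ℂ) volume

/-!
With `-e^{(ν-μ)πi} = e^{iψ}`, the hypothesis on `|μ - ν|` says exactly that
`|ψ| < π - απ/2`. In this sector the Mittag-Leffler function has the Mellin–Barnes representation

`E_α(-e^{iψ} x) = ∫ Φ(σ + iτ) x^{-(σ + iτ)} dτ`, `Φ(s) = e^{-iψs} / (2 sin(πs) Γ(1 - αs))`,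

for `x > 0` and every `σ ∈ (0, 1)`, and `Φ` decays exponentially on vertical lines
(`hasSum_mittagLeffler`, `exists_norm_mellinDensity_le`). It is proved by moving the line of
integration to the left: each unit step picks up one term of the power series
(`integral_div_sin_add_integral_div_sin`), and the super-exponential decay of `1 / Γ` disposes of
the remainder. The estimates on `Γ` and `1 / Γ` come from the exact value of `|Γ(1/2 + iy)|`, the
Beta integral and the reflection formula.

The symbol is thus a superposition of the powers `t^{-αs} |ξ|^{-βs}`, `Re s = σ`. The inverse
Fourier transform of `|ξ|^{-a}` for `0 < Re a < d` is an explicit multiple of `|x|^{a-d}`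
(`integral_cpow_norm_mul_fourierInv`), and the constant grows on vertical lines more slowly than any
exponential (`exists_norm_rieszConst_le`), so that the superposition can be inverted under the
integral sign. This produces the kernel `V` and the bounds

`|V(t, x)| ≤ C_σ t^{-ασ} |x|^{βσ-d}`, `0 < σ < min(1, d/β)`,

which hold for every kernel because inverse Fourier transforms are unique almost everywhere
(`IsInverseFourier.ae_eq`). Put `δ = 1/p - 1/q` and `1/r = 1 - δ`. If `r < ∞`, two values of `σ` on
either side of `δd/β` place `V(t, ·)` in `L ^ r` with norm at most `C t^{-αdδ/β}`
(`exists_eLpNorm_kernel_le`); here `σ < 1` is available exactly because `δ < β/d`. If `r = ∞`, then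
`β > d`, the symbol is integrable, and its `L¹` norm bounds `V`
(`exists_eLpNorm_top_kernel_le`). Young's convolution inequality, proved here from Hölder's
inequality for three functions, concludes.
-/

/-! ### Bounds for the Gamma function -/

theorem norm_betaIntegral_le {s : ℂ} (w : ℝ) :
    ‖Complex.betaIntegral s w‖ ≤ ‖Complex.betaIntegral (s.re : ℂ) w‖ := by
  have h0 : ∀ x ∈ Set.Ioo (0 : ℝ) 1, ‖(x : ℂ) ^ (s - 1) * (1 - (x : ℂ)) ^ ((w : ℂ) - 1)‖
      = x ^ (s.re - 1) * (1 - x) ^ (w - 1) := by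
    intro x hx
    rw [norm_mul, Complex.norm_cpow_eq_rpow_re_of_pos hx.1]
    have : (1 - (x : ℂ)) = ((1 - x : ℝ) : ℂ) := by push_cast; rfl
    rw [this, Complex.norm_cpow_eq_rpow_re_of_pos (by linarith [hx.2])]
    simp
  have hr : Complex.betaIntegral (s.re : ℂ) w
      = ((∫ x in Set.Ioo (0 : ℝ) 1, x ^ (s.re - 1) * (1 - x) ^ (w - 1) : ℝ) : ℂ) := by
    rw [Complex.betaIntegral, intervalIntegral.integral_of_le zero_le_one, integral_Ioc_eq_integral_Ioo,
      ← integral_complex_ofReal]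
    refine setIntegral_congr_fun measurableSet_Ioo fun x hx => ?_
    push_cast
    rw [Complex.ofReal_cpow hx.1.le, Complex.ofReal_cpow (by linarith [hx.2])]
    push_cast; rfl
  rw [hr, Complex.norm_real, Complex.betaIntegral, intervalIntegral.integral_of_le zero_le_one,
    integral_Ioc_eq_integral_Ioo]
  refine (norm_integral_le_integral_norm _).trans (le_trans (le_of_eq ?_) (le_abs_self _))
  exact setIntegral_congr_fun measurableSet_Ioo h0

/-- Along horizontal lines in the right half-plane, `|Γ(s + w)| / Γ(Re s + w)` increases
with `w`. -/
theorem norm_Gamma_mul_le {s : ℂ} (hs : 0 < s.re) {w : ℝ} (hw : 0 < w) :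
    ‖Complex.Gamma s‖ * Real.Gamma (s.re + w) ≤ ‖Complex.Gamma (s + w)‖ * Real.Gamma s.re := by
  have h1 := Complex.Gamma_mul_Gamma_eq_betaIntegral hs (t := (w : ℂ)) (by simpa using hw)
  have h2 := Complex.Gamma_mul_Gamma_eq_betaIntegral (s := (s.re : ℂ)) (by simpa using hs)
    (t := (w : ℂ)) (by simpa using hw)
  have hG := Real.Gamma_pos_of_pos hw
  have hG1 := Real.Gamma_pos_of_pos hs
  have hG2 := Real.Gamma_pos_of_pos (add_pos hs hw)
  have h1' := congrArg norm h1
  have h2' := congrArg norm h2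
  rw [← Complex.ofReal_add] at h2'
  simp only [norm_mul, Complex.Gamma_ofReal, Complex.norm_real, Real.norm_eq_abs, abs_of_pos hG,
    abs_of_pos hG1, abs_of_pos hG2] at h1' h2'
  refine le_of_mul_le_mul_right ?_ hG
  calc ‖Complex.Gamma s‖ * Real.Gamma (s.re + w) * Real.Gamma w
      = ‖Complex.Gamma (s + w)‖ * (Real.Gamma (s.re + w) * ‖Complex.betaIntegral s w‖) := by
        rw [mul_right_comm, h1']; ring
    _ ≤ ‖Complex.Gamma (s + w)‖ *
        (Real.Gamma (s.re + w) * ‖Complex.betaIntegral (s.re : ℂ) w‖) := by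
        gcongr; exact norm_betaIntegral_le w
    _ = _ := by rw [← h2']; ring

theorem norm_Gamma_half_sq (y : ℝ) :
    ‖Complex.Gamma (1 / 2 + y * Complex.I)‖ ^ 2 = Real.pi / Real.cosh (Real.pi * y) := by
  have h := Complex.Gamma_mul_Gamma_one_sub (1 / 2 + y * Complex.I)
  have h1 : (1 : ℂ) - (1 / 2 + y * Complex.I) = (starRingEnd ℂ) (1 / 2 + y * Complex.I) := by
    simp only [map_add, map_mul, Complex.conj_I, Complex.conj_ofReal, map_div₀, map_one]
    simp only [map_ofNat]; ring
  rw [h1, Complex.Gamma_conj] at h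
  have h2 : Complex.sin (Real.pi * (1 / 2 + y * Complex.I)) = Real.cosh (Real.pi * y) := by
    have : (Real.pi : ℂ) * (1 / 2 + y * Complex.I)
        = Real.pi / 2 - (-(Real.pi * y : ℝ) * Complex.I) := by push_cast; ring
    rw [this, Complex.sin_pi_div_two_sub, ← Complex.ofReal_neg, Complex.cos_mul_I,
      ← Complex.ofReal_cosh, Real.cosh_neg]
  rw [h2] at h
  have h3 := congrArg norm h
  rw [norm_mul, Complex.norm_conj, norm_div, Complex.norm_real, Complex.norm_real, Real.norm_eq_abs,
    Real.norm_eq_abs, abs_of_pos Real.pi_pos, abs_of_pos (Real.cosh_pos _)] at h3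
  rw [sq, h3]

theorem Real.cosh_le_exp_abs (x : ℝ) : Real.cosh x ≤ Real.exp |x| := by
  rw [← Real.cosh_abs, Real.cosh_eq]
  have : Real.exp (-|x|) ≤ Real.exp |x| := Real.exp_le_exp.2 (by linarith [abs_nonneg x])
  linarith

theorem norm_inv_Gamma_le_of_half_lt {z : ℂ} (hz : 1 / 2 < z.re) :
    ‖(Complex.Gamma z)⁻¹‖ ≤ Real.exp (Real.pi / 2 * |z.im|) / Real.Gamma z.re := by
  set s : ℂ := 1 / 2 + z.im * Complex.I with hs
  have hsre : s.re = 1 / 2 := by simp [hs]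
  have h := norm_Gamma_mul_le (s := s) (by rw [hsre]; norm_num) (w := z.re - 1 / 2) (by linarith)
  have hsz : s + ((z.re - 1 / 2 : ℝ) : ℂ) = z := by
    apply Complex.ext <;> simp [hs]
  rw [hsz, hsre, add_sub_cancel, Real.Gamma_one_half_eq] at h
  have h2 := norm_Gamma_half_sq z.im
  rw [← hs] at h2
  have hc := Real.cosh_pos (Real.pi * z.im)
  have hG := Real.Gamma_pos_of_pos (show 0 < z.re by linarith)
  have hzG : 0 < ‖Complex.Gamma z‖ :=
    norm_pos_iff.2 (Complex.Gamma_ne_zero_of_re_pos (by linarith))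
  have hsG : Real.sqrt Real.pi * Real.exp (-(Real.pi / 2 * |z.im|)) ≤ ‖Complex.Gamma s‖ := by
    refine (sq_le_sq₀ (by positivity) (norm_nonneg _)).1 ?_
    rw [h2, mul_pow, Real.sq_sqrt Real.pi_pos.le, le_div_iff₀ hc, mul_assoc]
    refine mul_le_of_le_one_right Real.pi_pos.le ?_
    have := Real.cosh_le_exp_abs (Real.pi * z.im)
    rw [abs_mul, abs_of_pos Real.pi_pos] at this
    calc _ ≤ Real.exp (-(Real.pi / 2 * |z.im|)) ^ 2 * Real.exp (Real.pi * |z.im|) := by gcongr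
      _ = 1 := by
        rw [sq, ← Real.exp_add, ← Real.exp_add, Real.exp_eq_one_iff]; ring
  rw [norm_inv, le_div_iff₀ hG, inv_mul_le_iff₀ hzG]
  have hsp : 0 < Real.sqrt Real.pi := Real.sqrt_pos.2 Real.pi_pos
  refine le_of_mul_le_mul_right (a := Real.sqrt Real.pi * Real.exp (-(Real.pi / 2 * |z.im|))) ?_
    (by positivity)
  calc _ ≤ Real.Gamma z.re * ‖Complex.Gamma s‖ := by gcongr
    _ ≤ ‖Complex.Gamma z‖ * Real.sqrt Real.pi := by linarith
    _ = _ := by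
      rw [Real.exp_neg]; field_simp

theorem rpow_mul_exp_neg_le_Gamma {M u : ℝ} (hM : 0 < M) (hu : 1 ≤ u) :
    M ^ (u - 1) * Real.exp (-M) ≤ Real.Gamma u := by
  have hu0 : 0 < u := by linarith
  rw [Real.Gamma_eq_integral hu0]
  have hi := Real.GammaIntegral_convergent hu0
  calc M ^ (u - 1) * Real.exp (-M) = ∫ x in Set.Ioi M, M ^ (u - 1) * Real.exp (-x) := by
        rw [integral_const_mul, integral_exp_neg_Ioi]
    _ ≤ ∫ x in Set.Ioi M, Real.exp (-x) * x ^ (u - 1) := by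
        refine setIntegral_mono_on ((integrableOn_exp_neg_Ioi M).const_mul _)
          (hi.mono_set (Set.Ioi_subset_Ioi hM.le)) measurableSet_Ioi fun x hx => ?_
        rw [mul_comm]
        gcongr
        exact (le_of_lt hx)
    _ ≤ _ := by
        refine setIntegral_mono_set hi ?_ (Set.Ioi_subset_Ioi hM.le).eventuallyLE
        refine (ae_restrict_iff' measurableSet_Ioi).2 (Filter.Eventually.of_forall fun x hx => ?_)
        have : (0 : ℝ) < x := hx
        simp only [Pi.zero_apply]
        positivity

theorem le_exp_mul_div {ε x : ℝ} (hε : 0 < ε) : x ≤ Real.exp (ε * x) / ε := by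
  rw [le_div_iff₀ hε]
  linarith [Real.add_one_le_exp (ε * x)]

/-- The reciprocal Gamma function grows at most like `e^{(π/2 + ε)|Im z|}` in the imaginary
direction, and decays faster than any exponential to the right. -/
theorem exists_norm_inv_Gamma_le {ε M : ℝ} (hε : 0 < ε) (hM : 0 < M) :
    ∃ C : ℝ, 0 < C ∧ ∀ z : ℂ, -1 ≤ z.re →
      ‖(Complex.Gamma z)⁻¹‖ ≤ C * Real.exp ((Real.pi / 2 + ε) * |z.im|) * M ^ (-z.re) := by
  -- the polynomial factor `|z (z + 1)|` costs `e^{ε Re z}`, which enlarging `M` repays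
  set e := ε / 2 with he
  have he0 : 0 < e := by positivity
  set M' := M * Real.exp ε with hM'
  have hM0 : 0 < M' := by positivity
  refine ⟨Real.exp (e * 3) / e * (Real.exp (e * 3) / e) * Real.exp M' * M'⁻¹, by positivity,
    fun z hz => ?_⟩
  have h2 : (Complex.Gamma z)⁻¹ = z * (z + 1) * (Complex.Gamma (z + 2))⁻¹ := by
    have h := Complex.one_div_Gamma_eq_self_mul_one_div_Gamma_add_one z
    have h' := Complex.one_div_Gamma_eq_self_mul_one_div_Gamma_add_one (z + 1)
    rw [h, h', mul_assoc]
    ring_nf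
  have hre : (z + 2).re = z.re + 2 := by simp
  have him : (z + 2).im = z.im := by simp
  have h3 := norm_inv_Gamma_le_of_half_lt (z := z + 2) (by rw [hre]; linarith)
  rw [hre, him] at h3
  have h4 := rpow_mul_exp_neg_le_Gamma (M := M') (u := z.re + 2) hM0 (by linarith)
  have hz1 : ‖z‖ ≤ z.re + 3 + |z.im| := by
    have := Complex.norm_le_abs_re_add_abs_im z
    have h' : |z.re| ≤ z.re + 2 := abs_le.2 ⟨by linarith, by linarith⟩
    linarith
  have hz2 : ‖z + 1‖ ≤ z.re + 3 + |z.im| := by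
    have := Complex.norm_le_abs_re_add_abs_im (z + 1)
    simp only [Complex.add_re, Complex.one_re, Complex.add_im, Complex.one_im, add_zero] at this
    rw [abs_of_nonneg (by linarith : 0 ≤ z.re + 1)] at this
    linarith
  have h5 := le_exp_mul_div (x := z.re + 3 + |z.im|) he0
  have h6 : Real.exp (Real.pi / 2 * |z.im|) / Real.Gamma (z.re + 2)
      ≤ Real.exp (Real.pi / 2 * |z.im|) / (M' ^ (z.re + 2 - 1) * Real.exp (-M')) := by
    gcongr
  rw [h2, norm_mul, norm_mul]
  calc ‖z‖ * ‖z + 1‖ * ‖(Complex.Gamma (z + 2))⁻¹‖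
      ≤ (Real.exp (e * (z.re + 3 + |z.im|)) / e) * (Real.exp (e * (z.re + 3 + |z.im|)) / e) *
        (Real.exp (Real.pi / 2 * |z.im|) / (M' ^ (z.re + 2 - 1) * Real.exp (-M'))) := by
        gcongr
        · exact hz1.trans h5
        · exact hz2.trans h5
        · exact h3.trans h6
    _ = _ := by
      have e1 : M' ^ (z.re + 2 - 1) = M ^ z.re * Real.exp (ε * z.re) * M' := by
        rw [show z.re + 2 - 1 = z.re + 1 by ring, Real.rpow_add hM0, Real.rpow_one, hM',
          Real.mul_rpow hM.le (Real.exp_pos _).le, ← Real.exp_mul]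
      have e2 : Real.exp (e * (z.re + 3 + |z.im|))
          = Real.exp (e * 3) * Real.exp (e * z.re) * Real.exp (e * |z.im|) := by
        rw [← Real.exp_add, ← Real.exp_add]; ring_nf
      have e3 : Real.exp ((Real.pi / 2 + ε) * |z.im|)
          = Real.exp (Real.pi / 2 * |z.im|) * Real.exp (e * |z.im|) * Real.exp (e * |z.im|) := by
        rw [← Real.exp_add, ← Real.exp_add, he]; ring_nf
      have e4 : Real.exp (ε * z.re) = Real.exp (e * z.re) * Real.exp (e * z.re) := by
        rw [← Real.exp_add, he]; ring_nf
      rw [e1, e2, e3, e4, Real.rpow_neg hM.le, Real.exp_neg]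
      field_simp

theorem norm_sin_sq (x y : ℝ) :
    ‖Complex.sin (x + y * Complex.I)‖ ^ 2 = Real.sin x ^ 2 + Real.sinh y ^ 2 := by
  rw [Complex.sin_add_mul_I, ← Complex.normSq_eq_norm_sq, ← Complex.ofReal_sin,
    ← Complex.ofReal_cosh, ← Complex.ofReal_cos, ← Complex.ofReal_sinh, ← Complex.ofReal_mul,
    ← Complex.ofReal_mul, Complex.normSq_add_mul_I, mul_pow, mul_pow, Real.cosh_sq, Real.cos_sq']
  ring

theorem exp_abs_le_two_mul_cosh (y : ℝ) : Real.exp |y| ≤ 2 * Real.cosh y := by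
  rw [← Real.cosh_abs, Real.cosh_eq]
  linarith [Real.exp_pos (-|y|)]

theorem abs_sin_mul_exp_le_norm_sin (x y : ℝ) :
    |Real.sin x| * Real.exp |y| ≤ 2 * ‖Complex.sin (x + y * Complex.I)‖ := by
  have h : |Real.sin x| * Real.cosh y ≤ ‖Complex.sin (x + y * Complex.I)‖ := by
    refine (sq_le_sq₀ (by positivity) (norm_nonneg _)).1 ?_
    rw [norm_sin_sq, mul_pow, sq_abs, Real.cosh_sq]
    nlinarith [Real.sin_sq_le_one x, sq_nonneg (Real.sinh y)]
  nlinarith [exp_abs_le_two_mul_cosh y, abs_nonneg (Real.sin x)]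

theorem exp_abs_le_norm_sin (x : ℝ) {y : ℝ} (hy : 1 ≤ |y|) :
    Real.exp |y| ≤ 4 * ‖Complex.sin (x + y * Complex.I)‖ := by
  have h : Real.sinh |y| ≤ ‖Complex.sin (x + y * Complex.I)‖ := by
    refine (sq_le_sq₀ (Real.sinh_nonneg_iff.2 (abs_nonneg y)) (norm_nonneg _)).1 ?_
    rw [norm_sin_sq, ← Real.abs_sinh, sq_abs]
    nlinarith [sq_nonneg (Real.sin x)]
  rw [Real.sinh_eq] at h
  have h1 : Real.exp (-|y|) ≤ 1 := Real.exp_le_one_iff.2 (by linarith)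
  have h2 := Real.add_one_le_exp |y|
  linarith

/-- The Gamma function decays exponentially along vertical lines in the right half-plane, at every
rate below `π / 2`. On `0 < Re s ≤ 1` this is the reflection formula combined with the bound
for `1 / Γ`; the functional equation moves it to the right. -/
theorem exists_norm_Gamma_le {a ε : ℝ} (ha : 0 < a) (hε : 0 < ε) :
    ∃ C : ℝ, 0 < C ∧ ∀ y : ℝ,
      ‖Complex.Gamma (a + y * Complex.I)‖ ≤ C * Real.exp (-((Real.pi / 2 - ε) * |y|)) := by
  have key : ∀ n : ℕ, ∀ ε : ℝ, 0 < ε → ∀ a : ℝ, 0 < a → a ≤ n + 1 → ∃ C : ℝ, 0 < C ∧ ∀ y : ℝ,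
      ‖Complex.Gamma (a + y * Complex.I)‖ ≤ C * Real.exp (-((Real.pi / 2 - ε) * |y|)) := by
    intro n
    induction n with
    | zero =>
      intro ε hε a ha ha1
      norm_num at ha1
      obtain ⟨C, hC, hb⟩ := exists_norm_inv_Gamma_le hε (zero_lt_one (α := ℝ))
      have hG := Real.Gamma_pos_of_pos ha
      refine ⟨4 * Real.pi * C + Real.Gamma a * Real.exp (Real.pi / 2), by positivity, fun y => ?_⟩
      rcases le_total 1 |y| with hy | hy
      · have h := Complex.Gamma_mul_Gamma_one_sub (a + y * Complex.I)
        have h1 : Complex.Gamma (1 - (a + y * Complex.I)) ≠ 0 := by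
          refine Complex.Gamma_ne_zero fun m hm => ?_
          have := congrArg Complex.im hm
          simp at this
          rw [this] at hy
          norm_num at hy
        have h2 := hb (1 - (a + y * Complex.I)) (by simp; linarith)
        have h3 : (1 - (a + y * Complex.I)).im = -y := by simp
        rw [h3, abs_neg, Real.one_rpow, mul_one] at h2
        have h4 := exp_abs_le_norm_sin (Real.pi * a) (y := Real.pi * y) (by
          rw [abs_mul, abs_of_pos Real.pi_pos]; nlinarith [Real.pi_gt_three])
        have h5 : Real.pi * ((a : ℂ) + y * Complex.I)
            = ((Real.pi * a : ℝ) : ℂ) + ((Real.pi * y : ℝ) : ℂ) * Complex.I := by push_cast; ring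
        rw [eq_div_of_mul_eq h1 h, div_eq_mul_inv, norm_mul, norm_div, Complex.norm_real, Real.norm_eq_abs,
          abs_of_pos Real.pi_pos, h5]
        rw [abs_mul, abs_of_pos Real.pi_pos] at h4
        set S := ‖Complex.sin (((Real.pi * a : ℝ) : ℂ) + ((Real.pi * y : ℝ) : ℂ) * Complex.I)‖
        have hS : Real.pi / S ≤ 4 * Real.pi * Real.exp (-(Real.pi * |y|)) := by
          have : 0 < S := by linarith [Real.exp_pos (Real.pi * |y|)]
          rw [div_le_iff₀ this, Real.exp_neg]
          have hp := Real.exp_pos (Real.pi * |y|)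
          calc Real.pi = Real.pi * (Real.exp (Real.pi * |y|))⁻¹ * Real.exp (Real.pi * |y|) := by
                field_simp
            _ ≤ Real.pi * (Real.exp (Real.pi * |y|))⁻¹ * (4 * S) := by gcongr
            _ = _ := by ring
        calc _ ≤ (4 * Real.pi * Real.exp (-(Real.pi * |y|)))
              * (C * Real.exp ((Real.pi / 2 + ε) * |y|)) := by gcongr
          _ = 4 * Real.pi * C * Real.exp (-((Real.pi / 2 - ε) * |y|)) := by
            rw [show -((Real.pi / 2 - ε) * |y|) = -(Real.pi * |y|) + (Real.pi / 2 + ε) * |y| by ring,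
              Real.exp_add]
            ring
          _ ≤ _ := by
            gcongr
            have := Real.exp_pos (Real.pi / 2)
            nlinarith
      · have h1 : ‖Complex.Gamma (a + y * Complex.I)‖ ≤ Real.Gamma a := by
          rw [Complex.Gamma_eq_integral (by simpa using ha), Real.Gamma_eq_integral ha,
            Complex.GammaIntegral]
          refine (norm_integral_le_integral_norm _).trans (le_of_eq ?_)
          refine setIntegral_congr_fun measurableSet_Ioi fun t ht => ?_
          simp only [norm_mul]
          rw [Complex.norm_cpow_eq_rpow_re_of_pos ht, Complex.norm_real, Real.norm_eq_abs, Real.abs_exp]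
          simp
        refine h1.trans ?_
        have h2 : Real.Gamma a ≤ Real.Gamma a * Real.exp (Real.pi / 2)
            * Real.exp (-((Real.pi / 2 - ε) * |y|)) := by
          rw [mul_assoc, ← Real.exp_add]
          refine le_mul_of_one_le_right hG.le (Real.one_le_exp ?_)
          nlinarith [Real.pi_pos, abs_nonneg y, mul_nonneg hε.le (abs_nonneg y)]
        refine h2.trans ?_
        gcongr
        have := Real.pi_pos
        have : 0 ≤ 4 * Real.pi * C := by positivity
        linarith
    | succ n ih =>
      intro ε hε a ha ha1
      rcases le_or_gt a 1 with h1 | h1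
      · refine ih ε hε a ha ?_
        have : (0 : ℝ) ≤ n := n.cast_nonneg
        linarith
      · obtain ⟨C, hC, hb⟩ := ih (ε / 2) (by positivity) (a - 1) (by linarith)
          (by push_cast at ha1; linarith)
        refine ⟨Real.exp (ε / 2 * a) / (ε / 2) * C, by positivity, fun y => ?_⟩
        set s : ℂ := ((a - 1 : ℝ) : ℂ) + y * Complex.I with hs
        have hs0 : s ≠ 0 := by
          intro h
          have := congrArg Complex.re h
          simp [hs] at this
          linarith
        have hs1 : (a : ℂ) + y * Complex.I = s + 1 := by rw [hs]; push_cast; ring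
        have hsn : ‖s‖ ≤ a + |y| := by
          refine (norm_add_le _ _).trans ?_
          rw [norm_mul, Complex.norm_real, Complex.norm_real, Complex.norm_I, mul_one,
            Real.norm_eq_abs, Real.norm_eq_abs, abs_of_pos (by linarith)]
          linarith
        rw [hs1, Complex.Gamma_add_one s hs0, norm_mul]
        calc _ ≤ (Real.exp (ε / 2 * (a + |y|)) / (ε / 2))
              * (C * Real.exp (-((Real.pi / 2 - ε / 2) * |y|))) := by
              gcongr
              · exact hsn.trans (le_exp_mul_div (by positivity))
              · exact hb y
          _ = _ := by
            rw [show -((Real.pi / 2 - ε) * |y|) = -((Real.pi / 2 - ε / 2) * |y|) + ε / 2 * |y| by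
              ring, Real.exp_add, mul_add, Real.exp_add]
            ring
  obtain ⟨n, hn⟩ := exists_nat_ge a
  exact key n ε hε a ha (by linarith)

/-! ### Shifting a vertical line of integration -/

theorem integrable_exp_neg_mul_abs {δ : ℝ} (hδ : 0 < δ) :
    Integrable fun τ : ℝ => Real.exp (-(δ * |τ|)) := by
  rw [← integrableOn_univ, ← Set.Iic_union_Ioi (a := (0 : ℝ))]
  refine IntegrableOn.union ?_ ?_
  · refine (integrableOn_exp_mul_Iic hδ 0).congr_fun (fun τ hτ => ?_) measurableSet_Iic
    have : τ ≤ 0 := hτ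
    simp only [abs_of_nonpos this]
    ring_nf
  · refine (integrableOn_exp_mul_Ioi (a := -δ) (by linarith) 0).congr_fun (fun τ hτ => ?_)
      measurableSet_Ioi
    have : 0 < τ := hτ
    simp only [abs_of_pos this]
    ring_nf

theorem integrable_of_norm_le_exp_neg_mul_abs {f : ℝ → ℂ} (hf : Continuous f) {C δ : ℝ} (hδ : 0 < δ)
    (hb : ∀ τ, ‖f τ‖ ≤ C * Real.exp (-(δ * |τ|))) : Integrable f :=
  ((integrable_exp_neg_mul_abs hδ).const_mul C).mono' hf.aestronglyMeasurable
    (Filter.Eventually.of_forall hb)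

/-- Cauchy's theorem for a vertical strip, for functions decaying exponentially at its two ends. -/
theorem integral_verticalLine_eq {H : ℂ → ℂ} {a b C δ : ℝ} (hδ : 0 < δ) (hab : a ≤ b)
    (hd : ∀ s : ℂ, s.re ∈ Set.Icc a b → DifferentiableAt ℂ H s)
    (ha : Integrable fun τ : ℝ => H (a + τ * Complex.I))
    (hb : Integrable fun τ : ℝ => H (b + τ * Complex.I))
    (hH : ∀ x ∈ Set.Icc a b, ∀ y : ℝ, 1 ≤ |y| →
      ‖H (x + y * Complex.I)‖ ≤ C * Real.exp (-(δ * |y|))) :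
    ∫ τ : ℝ, H (a + τ * Complex.I) = ∫ τ : ℝ, H (b + τ * Complex.I) := by
  have hrect : ∀ T : ℝ, (∫ x : ℝ in a..b, H (x + (-T : ℝ) * Complex.I))
      - (∫ x : ℝ in a..b, H (x + T * Complex.I))
      + Complex.I * (∫ y : ℝ in (-T)..T, H (b + y * Complex.I))
      - Complex.I * (∫ y : ℝ in (-T)..T, H (a + y * Complex.I)) = 0 := by
    intro T
    have := Complex.integral_boundary_rect_eq_zero_of_differentiableOn H (a + (-T : ℝ) * Complex.I)
      (b + T * Complex.I) (fun s hs => (hd s ?_).differentiableWithinAt)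
    · simpa using this
    · have := (Complex.mem_reProdIm.1 hs).1
      simp only [Complex.add_re, Complex.ofReal_re, Complex.mul_re, Complex.I_re, mul_zero,
        Complex.ofReal_im, Complex.I_im, zero_mul, sub_zero, add_zero] at this
      rwa [Set.uIcc_of_le hab] at this
  have hexp : Filter.Tendsto (fun T : ℝ => C * Real.exp (-(δ * T)) * |b - a|) Filter.atTop
      (nhds 0) := by
    have h1 : Filter.Tendsto (fun T : ℝ => Real.exp (-(δ * T))) Filter.atTop (nhds 0) :=
      Real.tendsto_exp_neg_atTop_nhds_zero.comp (Filter.tendsto_id.const_mul_atTop hδ)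
    simpa using (h1.const_mul C).mul_const |b - a|
  have hor : ∀ ε : ℝ, |ε| = 1 → Filter.Tendsto
      (fun T : ℝ => ∫ x : ℝ in a..b, H (x + (ε * T : ℝ) * Complex.I)) Filter.atTop (nhds 0) := by
    intro ε hε
    refine squeeze_zero_norm' ?_ hexp
    filter_upwards [Filter.eventually_ge_atTop 1] with T hT
    have hT0 : |ε * T| = T := by rw [abs_mul, hε, one_mul, abs_of_pos (by linarith)]
    refine intervalIntegral.norm_integral_le_of_norm_le_const fun x hx => ?_
    rw [Set.uIoc_of_le hab] at hx
    have := hH x ⟨hx.1.le, hx.2⟩ (ε * T) (by rw [hT0]; exact hT)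
    rwa [hT0] at this
  have h1 := hor (-1) (by simp)
  have h2 := hor 1 (by simp)
  have h3 := intervalIntegral_tendsto_integral hb Filter.tendsto_neg_atTop_atBot Filter.tendsto_id
  have h4 := intervalIntegral_tendsto_integral ha Filter.tendsto_neg_atTop_atBot Filter.tendsto_id
  have h5 := ((h1.sub h2).add (h3.const_mul Complex.I)).sub (h4.const_mul Complex.I)
  have h6 := tendsto_nhds_unique (h5.congr fun T => by
    simpa using hrect T) tendsto_const_nhds
  have h7 : Complex.I * ((∫ τ : ℝ, H (b + τ * Complex.I)) - ∫ τ : ℝ, H (a + τ * Complex.I)) = 0 := by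
    rw [mul_sub]; simpa using h6
  exact (sub_eq_zero.1 ((mul_eq_zero.1 h7).resolve_left Complex.I_ne_zero)).symm

/-! ### The kernel `1 / sin (π s)` -/

theorem pi_mul_add_mul_I (x y : ℝ) : (Real.pi : ℂ) * (x + y * Complex.I)
    = ((Real.pi * x : ℝ) : ℂ) + ((Real.pi * y : ℝ) : ℂ) * Complex.I := by
  push_cast; ring

theorem sin_pi_mul_pos {σ : ℝ} (h0 : 0 < σ) (h1 : σ < 1) : 0 < Real.sin (Real.pi * σ) :=
  Real.sin_pos_of_pos_of_lt_pi (by positivity) (by nlinarith [Real.pi_pos])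

theorem complex_sin_pi_mul_ne_zero {s : ℂ} (h0 : s ≠ 0) (h1 : |s.re| < 1) :
    Complex.sin (Real.pi * s) ≠ 0 := by
  intro h
  obtain ⟨k, hk⟩ := Complex.sin_eq_zero_iff.1 h
  have hs : s = k := by
    have : (Real.pi : ℂ) ≠ 0 := Complex.ofReal_ne_zero.2 Real.pi_ne_zero
    exact mul_left_cancel₀ this (by rw [hk]; ring)
  rw [hs] at h1 h0
  simp only [Complex.intCast_re] at h1
  have : k = 0 := by
    have : |k| < 1 := by exact_mod_cast h1
    exact Int.abs_lt_one_iff.1 this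
  simp [this] at h0

theorem norm_inv_sin_le {σ : ℝ} (h0 : 0 < σ) (h1 : σ < 1) (τ : ℝ) :
    ‖(Complex.sin (Real.pi * (σ + τ * Complex.I)))⁻¹‖
      ≤ 2 / Real.sin (Real.pi * σ) * Real.exp (-(Real.pi * |τ|)) := by
  have hs := sin_pi_mul_pos h0 h1
  have h := abs_sin_mul_exp_le_norm_sin (Real.pi * σ) (Real.pi * τ)
  rw [← pi_mul_add_mul_I, abs_mul, abs_of_pos Real.pi_pos, abs_of_pos hs] at h
  have hp : 0 < ‖Complex.sin (Real.pi * (σ + τ * Complex.I))‖ := by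
    have : 0 < Real.sin (Real.pi * σ) * Real.exp (Real.pi * |τ|) := by positivity
    linarith
  rw [norm_inv, Real.exp_neg]
  rw [inv_le_iff_one_le_mul₀ hp]
  field_simp
  linarith

theorem norm_inv_sin_le_of_one_le_abs (x : ℝ) {y : ℝ} (hy : 1 ≤ |y|) :
    ‖(Complex.sin (Real.pi * (x + y * Complex.I)))⁻¹‖ ≤ 4 * Real.exp (-(Real.pi * |y|)) := by
  have h := exp_abs_le_norm_sin (Real.pi * x) (y := Real.pi * y) (by
    rw [abs_mul, abs_of_pos Real.pi_pos]; nlinarith [Real.pi_gt_three])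
  rw [← pi_mul_add_mul_I, abs_mul, abs_of_pos Real.pi_pos] at h
  have hp : 0 < ‖Complex.sin (Real.pi * (x + y * Complex.I))‖ := by
    linarith [Real.exp_pos (Real.pi * |y|)]
  rw [norm_inv, Real.exp_neg, inv_le_iff_one_le_mul₀ hp]
  field_simp
  linarith

theorem continuous_inv_sin {σ : ℝ} (h0 : 0 < σ) (h1 : σ < 1) :
    Continuous fun τ : ℝ => (Complex.sin (Real.pi * (σ + τ * Complex.I)))⁻¹ := by
  refine Continuous.inv₀ (by fun_prop) fun τ => complex_sin_pi_mul_ne_zero ?_ ?_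
  · intro h
    have := congrArg Complex.re h
    simp at this
    exact h0.ne' this
  · simpa using abs_lt.2 ⟨by linarith, h1⟩

theorem integrable_inv_sin {σ : ℝ} (h0 : 0 < σ) (h1 : σ < 1) :
    Integrable fun τ : ℝ => (Complex.sin (Real.pi * (σ + τ * Complex.I)))⁻¹ :=
  integrable_of_norm_le_exp_neg_mul_abs (continuous_inv_sin h0 h1) Real.pi_pos
    (norm_inv_sin_le h0 h1)

theorem integral_inv_sin_half :
    ∫ τ : ℝ, (Complex.sin (Real.pi * (((1 / 2 : ℝ) : ℂ) + τ * Complex.I)))⁻¹ = 1 := by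
  have hc : ∀ τ : ℝ, (Complex.sin (Real.pi * (((1 / 2 : ℝ) : ℂ) + τ * Complex.I)))⁻¹
      = (((Real.cosh (Real.pi * τ))⁻¹ : ℝ) : ℂ) := by
    intro τ
    have : (Real.pi : ℂ) * (((1 / 2 : ℝ) : ℂ) + τ * Complex.I)
        = Real.pi / 2 - (-(Real.pi * τ : ℝ) * Complex.I) := by push_cast; ring
    rw [this, Complex.sin_pi_div_two_sub, ← Complex.ofReal_neg, Complex.cos_mul_I,
      ← Complex.ofReal_cosh, Real.cosh_neg, Complex.ofReal_inv]
  have hi := integrable_inv_sin (σ := 1 / 2) (by norm_num) (by norm_num)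
  simp_rw [hc] at hi ⊢
  have hi' : Integrable fun τ : ℝ => (Real.cosh (Real.pi * τ))⁻¹ := by
    simpa only [RCLike.re_to_complex, Complex.ofReal_re] using hi.re
  rw [integral_complex_ofReal]
  have hd : ∀ τ : ℝ, HasDerivAt (fun τ => 2 / Real.pi * Real.arctan (Real.exp (Real.pi * τ)))
      ((Real.cosh (Real.pi * τ))⁻¹) τ := by
    intro τ
    have h := ((((hasDerivAt_id τ).const_mul Real.pi).exp).arctan).const_mul (2 / Real.pi)
    refine h.congr_deriv ?_
    simp only [id]
    rw [Real.cosh_eq, Real.exp_neg]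
    have := Real.exp_pos (Real.pi * τ)
    have := Real.pi_pos
    field_simp
    ring
  have htop : Filter.Tendsto (fun τ => 2 / Real.pi * Real.arctan (Real.exp (Real.pi * τ)))
      Filter.atTop (nhds (2 / Real.pi * (Real.pi / 2))) :=
    (((Real.tendsto_arctan_atTop.mono_right nhdsWithin_le_nhds).comp
      (Real.tendsto_exp_atTop.comp (Filter.tendsto_id.const_mul_atTop Real.pi_pos)))).const_mul _
  have hbot : Filter.Tendsto (fun τ => 2 / Real.pi * Real.arctan (Real.exp (Real.pi * τ)))
      Filter.atBot (nhds (2 / Real.pi * Real.arctan 0)) :=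
    (((Real.continuous_arctan.tendsto 0).comp
      (Real.tendsto_exp_atBot.comp (Filter.tendsto_id.const_mul_atBot Real.pi_pos)))).const_mul _
  rw [integral_of_hasDerivAt_of_tendsto hd hi' hbot htop]
  have := Real.pi_pos
  simp

theorem integral_inv_sin {σ : ℝ} (h0 : 0 < σ) (h1 : σ < 1) :
    ∫ τ : ℝ, (Complex.sin (Real.pi * (σ + τ * Complex.I)))⁻¹ = 1 := by
  have key : ∀ a b : ℝ, 0 < a → a ≤ b → b < 1 →
      ∫ τ : ℝ, (Complex.sin (Real.pi * (a + τ * Complex.I)))⁻¹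
        = ∫ τ : ℝ, (Complex.sin (Real.pi * (b + τ * Complex.I)))⁻¹ := by
    intro a b ha hab hb
    refine integral_verticalLine_eq (H := fun s => (Complex.sin (Real.pi * s))⁻¹) Real.pi_pos hab
      (fun s hs => ?_) (integrable_inv_sin ha (by linarith)) (integrable_inv_sin (by linarith) hb)
      (fun x _ y hy => norm_inv_sin_le_of_one_le_abs x hy)
    refine DifferentiableAt.inv (by fun_prop) (complex_sin_pi_mul_ne_zero ?_ ?_)
    · rintro rfl
      have := hs.1
      simp at this
      linarith
    · exact abs_lt.2 ⟨by linarith [hs.1], by linarith [hs.2]⟩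
  rcases le_total σ (1 / 2) with h | h
  · rw [key σ (1 / 2) h0 h (by norm_num), integral_inv_sin_half]
  · rw [← key (1 / 2) σ (by norm_num) h h1, integral_inv_sin_half]

/-- Moving the line of integration in `∫ B(s) / sin(π s)` one unit to the left crosses the simple
pole at `0`. The residue is isolated by subtracting `B(0)`, which makes the singularity
removable. -/
theorem integral_div_sin_add_integral_div_sin {B : ℂ → ℂ} (hB : Differentiable ℂ B)
    {σ C δ : ℝ} (h0 : 0 < σ) (h1 : σ < 1) (hδ : 0 < δ) (hδπ : δ ≤ Real.pi)
    (hb : ∀ s : ℂ, s.re ∈ Set.Icc (σ - 1) σ → ‖B s‖ ≤ C * Real.exp ((Real.pi - δ) * |s.im|)) :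
    (∫ τ : ℝ, B (σ + τ * Complex.I) * (Complex.sin (Real.pi * (σ + τ * Complex.I)))⁻¹)
      + (∫ τ : ℝ, B (σ + τ * Complex.I - 1) * (Complex.sin (Real.pi * (σ + τ * Complex.I)))⁻¹)
      = 2 * B 0 := by
  set S : ℝ → ℂ := fun τ => (Complex.sin (Real.pi * (σ + τ * Complex.I)))⁻¹ with hS
  have hSc : Continuous S := continuous_inv_sin h0 h1
  have hSb := norm_inv_sin_le h0 h1
  have hC : 0 ≤ C := by
    have := (norm_nonneg _).trans (hb (σ : ℂ) ⟨by simp, by simp⟩)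
    simpa using this
  have hmul : ∀ K : ℝ, 0 ≤ K → ∀ τ : ℝ, C * Real.exp ((Real.pi - δ) * |τ|)
      * (K * Real.exp (-(Real.pi * |τ|))) = C * K * Real.exp (-(δ * |τ|)) := by
    intro K _ τ
    rw [show -(δ * |τ|) = (Real.pi - δ) * |τ| + -(Real.pi * |τ|) by ring, Real.exp_add]
    ring
  have hK : 0 ≤ 2 / Real.sin (Real.pi * σ) := by
    have := sin_pi_mul_pos h0 h1
    positivity
  have hi : ∀ n : ℂ, n = 0 ∨ n = 1 →
      Integrable fun τ : ℝ => B (σ + τ * Complex.I - n) * S τ := by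
    intro n hn
    refine integrable_of_norm_le_exp_neg_mul_abs (C := C * (2 / Real.sin (Real.pi * σ))) (δ := δ)
      ((hB.continuous.comp (by fun_prop)).mul hSc) hδ fun τ => ?_
    rw [norm_mul, ← hmul _ hK]
    have h2 := hb (σ + τ * Complex.I - n) (by rcases hn with rfl | rfl <;> simp)
    have h3 : (σ + τ * Complex.I - n).im = τ := by rcases hn with rfl | rfl <;> simp
    rw [h3] at h2
    exact mul_le_mul h2 (hSb τ) (norm_nonneg _) (by positivity)
  have hi0 := hi 0 (Or.inl rfl)
  have hi1 := hi 1 (Or.inr rfl)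
  simp only [sub_zero] at hi0
  have hSi : Integrable S := integrable_inv_sin h0 h1
  -- the quotient `(B s - B 0) / sin (π s)` with its removable singularity filled in
  set D : ℂ → ℂ := fun s => dslope B 0 s / dslope (fun s => Complex.sin (Real.pi * s)) 0 s with hD
  have hsd : Differentiable ℂ fun s : ℂ => Complex.sin (Real.pi * s) := by fun_prop
  have hDs : ∀ s : ℂ, s ≠ 0 → D s = (B s - B 0) * (Complex.sin (Real.pi * s))⁻¹ := by
    intro s hs
    rw [hD]
    simp only
    rw [dslope_of_ne _ hs, dslope_of_ne _ hs, slope_def_field, slope_def_field]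
    simp only [mul_zero, Complex.sin_zero, sub_zero]
    rw [div_div_div_cancel_right₀ hs, div_eq_mul_inv]
  have hdiff : ∀ f : ℂ → ℂ, Differentiable ℂ f → Differentiable ℂ (dslope f 0) := fun f hf =>
    differentiableOn_univ.1 ((Complex.differentiableOn_dslope Filter.univ_mem).2 hf.differentiableOn)
  have hDd : ∀ s : ℂ, s.re ∈ Set.Icc (σ - 1) σ → DifferentiableAt ℂ D s := by
    intro s hs
    refine (hdiff B hB s).div (hdiff _ hsd s) ?_
    rcases eq_or_ne s 0 with rfl | hs0
    · have h : HasDerivAt (fun s : ℂ => Complex.sin (Real.pi * s)) Real.pi 0 := by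
        simpa using ((hasDerivAt_id (0 : ℂ)).const_mul (Real.pi : ℂ)).csin
      rw [dslope_same, h.deriv]
      exact Complex.ofReal_ne_zero.2 Real.pi_ne_zero
    · rw [dslope_of_ne _ hs0, slope_def_field]
      simp only [mul_zero, Complex.sin_zero, sub_zero]
      exact div_ne_zero (complex_sin_pi_mul_ne_zero hs0
        (abs_lt.2 ⟨by linarith [hs.1], by linarith [hs.2]⟩)) hs0
  have hne : ∀ τ : ℝ, (σ : ℂ) + τ * Complex.I ≠ 0 := by
    intro τ h
    have := congrArg Complex.re h
    simp at this
    exact h0.ne' this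
  have hne1 : ∀ τ : ℝ, ((σ - 1 : ℝ) : ℂ) + τ * Complex.I ≠ 0 := by
    intro τ h
    have := congrArg Complex.re h
    simp at this
    linarith
  have hDr : ∀ τ : ℝ, D (σ + τ * Complex.I) = B (σ + τ * Complex.I) * S τ - B 0 * S τ := by
    intro τ
    rw [hDs _ (hne τ), sub_mul]
  have hDl : ∀ τ : ℝ, D (((σ - 1 : ℝ) : ℂ) + τ * Complex.I)
      = B 0 * S τ - B (σ + τ * Complex.I - 1) * S τ := by
    intro τ
    have e : ((σ - 1 : ℝ) : ℂ) + τ * Complex.I = σ + τ * Complex.I - 1 := by push_cast; ring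
    rw [hDs _ (hne1 τ), e, mul_sub, mul_one, Complex.sin_sub_pi, inv_neg]
    ring
  have hint := integral_verticalLine_eq (H := D) (a := σ - 1) (b := σ) (C := (C + C) * 4) hδ
    (by linarith) hDd
    (by simp_rw [hDl]; exact (hSi.const_mul _).sub hi1)
    (by simp_rw [hDr]; exact hi0.sub (hSi.const_mul _))
    (by
      intro x hx y hy
      have hxy : (x : ℂ) + y * Complex.I ≠ 0 := by
        intro h
        have := congrArg Complex.im h
        simp at this
        rw [this] at hy
        norm_num at hy
      rw [hDs _ hxy, norm_mul]
      have h2 := hb (x + y * Complex.I) (by simpa using hx)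
      have h3 := hb 0 ⟨by simp; linarith, by simpa using h0.le⟩
      simp only [Complex.zero_im, abs_zero, mul_zero, Real.exp_zero, mul_one] at h3
      have h4 : ‖B (x + y * Complex.I) - B 0‖ ≤ (C + C) * Real.exp ((Real.pi - δ) * |y|) := by
        refine (norm_sub_le _ _).trans ?_
        simp only [Complex.add_im, Complex.ofReal_im, Complex.mul_im, Complex.ofReal_re,
          Complex.I_im, mul_one, Complex.I_re, mul_zero, add_zero, zero_add] at h2
        have h5 : C ≤ C * Real.exp ((Real.pi - δ) * |y|) :=
          le_mul_of_one_le_right hC (Real.one_le_exp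
            (mul_nonneg (by linarith) (abs_nonneg _)))
        linarith
      refine (mul_le_mul h4 (norm_inv_sin_le_of_one_le_abs x hy) (norm_nonneg _)
        (by positivity)).trans (le_of_eq ?_)
      rw [show -(δ * |y|) = (Real.pi - δ) * |y| + -(Real.pi * |y|) by ring, Real.exp_add]
      ring)
  simp_rw [hDl, hDr] at hint
  rw [integral_sub (hSi.const_mul _) hi1, integral_sub hi0 (hSi.const_mul _), integral_const_mul,
    show ∫ τ, S τ = 1 from integral_inv_sin h0 h1] at hint
  linear_combination -hint

/-! ### A Mellin–Barnes integral for the Mittag-Leffler function -/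

/-- The Mellin–Barnes density `e^{-iψs} / (2 sin(πs) Γ(1 - αs))`: integrated against `x^{-s}` over a
vertical line in `0 < Re s < 1` it gives `E_α(-e^{iψ} x)`. -/
noncomputable def mellinDensity (α ψ : ℝ) (s : ℂ) : ℂ :=
  2⁻¹ * Complex.exp (-(s * (ψ * Complex.I))) * (Complex.Gamma (1 - α * s))⁻¹
    * (Complex.sin (Real.pi * s))⁻¹

/-- The numerator of the Mellin–Barnes integrand grows more slowly than `|sin(πs)|` in the imaginary
direction, and decays like `2 ^ Re s` to the left. -/
theorem exists_norm_exp_mul_inv_Gamma_le {α ψ x : ℝ} (hα : 0 < α) (hα2 : α < 2)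
    (hψ : |ψ| < Real.pi - α / 2 * Real.pi) (hx : 0 < x) :
    ∃ C δ : ℝ, 0 < C ∧ 0 < δ ∧ δ ≤ Real.pi ∧ ∀ s : ℂ, s.re ≤ 1 →
      ‖Complex.exp (-(s * (ψ * Complex.I + Real.log x))) * (Complex.Gamma (1 - α * s))⁻¹‖
        ≤ C * Real.exp ((Real.pi - δ) * |s.im|) * 2 ^ s.re := by
  set δ := (Real.pi - α / 2 * Real.pi - |ψ|) / 2 with hδ
  have hδ0 : 0 < δ := by rw [hδ]; linarith
  -- with this base the bound for `1 / Γ(1 - αs)` outweighs `x ^ (-Re s)` by the factor `2 ^ Re s`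
  have hM : 0 < (2 * x) ^ (α⁻¹) := by positivity
  obtain ⟨C, hC, hb⟩ := exists_norm_inv_Gamma_le (ε := δ / α) (by positivity) hM
  refine ⟨C * ((2 * x) ^ (α⁻¹))⁻¹, δ, by positivity, hδ0, ?_, fun s hs => ?_⟩
  · have : 0 < α / 2 * Real.pi := by positivity
    have := abs_nonneg ψ
    linarith [Real.pi_pos]
  · have hre : (1 - α * s).re = 1 - α * s.re := by simp
    have him : (1 - α * s).im = -(α * s.im) := by simp
    have h1 := hb (1 - α * s) (by rw [hre]; nlinarith)
    rw [hre, him, abs_neg, abs_mul, abs_of_pos hα] at h1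
    have h2 : ‖Complex.exp (-(s * (ψ * Complex.I + Real.log x)))‖
        ≤ Real.exp (|ψ| * |s.im|) * x ^ (-s.re) := by
      rw [Complex.norm_exp, Real.rpow_def_of_pos hx, ← Real.exp_add]
      refine Real.exp_le_exp.2 ?_
      have : (-(s * (ψ * Complex.I + Real.log x))).re = ψ * s.im + Real.log x * -s.re := by
        simp only [Complex.neg_re, Complex.mul_re, Complex.add_re, Complex.ofReal_re, Complex.I_re,
          mul_zero, Complex.ofReal_im, Complex.I_im, mul_one, sub_self, zero_add, Complex.add_im,
          Complex.mul_im, add_zero]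
        ring
      rw [this]
      have := le_abs_self (ψ * s.im)
      rw [abs_mul] at this
      linarith
    have h3 : ((2 * x) ^ (α⁻¹)) ^ (-(1 - α * s.re))
        = ((2 * x) ^ (α⁻¹))⁻¹ * (2 ^ s.re * x ^ s.re) := by
      rw [show -(1 - α * s.re) = -1 + α * s.re by ring, Real.rpow_add hM, Real.rpow_neg_one,
        ← Real.rpow_mul (by positivity), ← mul_assoc, inv_mul_cancel₀ hα.ne', one_mul,
        Real.mul_rpow (z := s.re) (by norm_num) hx.le]
    rw [h3] at h1
    rw [norm_mul]
    refine (mul_le_mul h2 h1 (norm_nonneg _) (by positivity)).trans (le_of_eq ?_)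
    have e : (Real.pi - δ) * |s.im| = |ψ| * |s.im| + (Real.pi / 2 + δ / α) * (α * |s.im|) := by
      have : δ / α * α = δ := div_mul_cancel₀ _ hα.ne'
      have h' : (Real.pi / 2 + δ / α) * (α * |s.im|) = (Real.pi / 2 * α + δ) * |s.im| := by
        rw [← mul_assoc, add_mul, this]
      rw [h', ← add_mul]
      congr 1
      linarith
    rw [e, Real.exp_add, Real.rpow_neg hx.le]
    have : x ^ s.re ≠ 0 := by positivity
    field_simp

/-- The kernel `1 / sin(πs)` cancels, on every line in `0 < Re s < 1`, the growth of the other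
factors: this is where the opening of the sector enters. -/
theorem exists_norm_mellinDensity_le {α ψ σ : ℝ} (hα : 0 < α) (hα2 : α < 2)
    (hψ : |ψ| < Real.pi - α / 2 * Real.pi) (h0 : 0 < σ) (h1 : σ < 1) :
    ∃ C δ : ℝ, 0 < C ∧ 0 < δ ∧ ∀ τ : ℝ,
      ‖mellinDensity α ψ (σ + τ * Complex.I)‖ ≤ C * Real.exp (-(δ * |τ|)) := by
  obtain ⟨C, δ, hC, hδ, -, hb⟩ := exists_norm_exp_mul_inv_Gamma_le hα hα2 hψ zero_lt_one
  have hs := sin_pi_mul_pos h0 h1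
  refine ⟨2⁻¹ * (C * 2 ^ σ) * (2 / Real.sin (Real.pi * σ)), δ, by positivity, hδ, fun τ => ?_⟩
  have h2 := hb (σ + τ * Complex.I) (by simpa using h1.le)
  simp only [Real.log_one, Complex.ofReal_zero, add_zero, Complex.add_re, Complex.ofReal_re,
    Complex.mul_re, Complex.I_re, mul_zero, Complex.ofReal_im, Complex.I_im, sub_zero,
    Complex.add_im, Complex.mul_im, mul_one, zero_add] at h2
  rw [mellinDensity, mul_assoc (2⁻¹ : ℂ), norm_mul, norm_mul]
  have h3 : ‖(2⁻¹ : ℂ)‖ = 2⁻¹ := by simp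
  rw [h3]
  calc _ ≤ 2⁻¹ * (C * Real.exp ((Real.pi - δ) * |τ|) * 2 ^ σ)
        * (2 / Real.sin (Real.pi * σ) * Real.exp (-(Real.pi * |τ|))) := by
        gcongr
        exact norm_inv_sin_le h0 h1 τ
    _ = _ := by
      rw [show -(δ * |τ|) = (Real.pi - δ) * |τ| + -(Real.pi * |τ|) by ring, Real.exp_add]
      ring

theorem differentiable_inv_Gamma : Differentiable ℂ fun s : ℂ => (Complex.Gamma s)⁻¹ :=
  Complex.differentiable_one_div_Gamma

theorem continuous_mellinDensity_line (α ψ : ℝ) {σ : ℝ} (h0 : 0 < σ) (h1 : σ < 1) :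
    Continuous fun τ : ℝ => mellinDensity α ψ (σ + τ * Complex.I) := by
  unfold mellinDensity
  refine Continuous.mul ?_ (continuous_inv_sin h0 h1)
  exact (by fun_prop : Continuous fun τ : ℝ => (2⁻¹ : ℂ)
    * Complex.exp (-((σ + τ * Complex.I) * (ψ * Complex.I)))).mul
    (differentiable_inv_Gamma.continuous.comp (by fun_prop))

/-- Moving the line of integration to `Re s = -∞` collects the residues at `0, -1, -2, …`, which
are the terms of the Mittag-Leffler series. -/
theorem hasSum_mittagLeffler {α ψ σ x : ℝ} (hα : 0 < α) (hα2 : α < 2)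
    (hψ : |ψ| < Real.pi - α / 2 * Real.pi) (h0 : 0 < σ) (h1 : σ < 1) (hx : 0 < x) :
    HasSum (fun k : ℕ => (-(Complex.exp (ψ * Complex.I) * x)) ^ k
        / Complex.Gamma ((α * k + 1 : ℝ) : ℂ))
      (∫ τ : ℝ, mellinDensity α ψ (σ + τ * Complex.I) * (x : ℂ) ^ (-(σ + τ * Complex.I : ℂ))) := by
  obtain ⟨C, δ, hC, hδ, hδπ, hb⟩ := exists_norm_exp_mul_inv_Gamma_le hα hα2 hψ hx
  set B : ℂ → ℂ := fun s => Complex.exp (-(s * (ψ * Complex.I + Real.log x)))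
    * (Complex.Gamma (1 - α * s))⁻¹ with hBdef
  have hBd : Differentiable ℂ B := by
    refine Differentiable.mul (by fun_prop) (differentiable_inv_Gamma.comp (by fun_prop))
  set S : ℝ → ℂ := fun τ => (Complex.sin (Real.pi * (σ + τ * Complex.I)))⁻¹ with hS
  set J : ℕ → ℂ := fun N => 2⁻¹ * ∫ τ : ℝ, B (σ + τ * Complex.I - N) * S τ with hJ
  have hstep : ∀ N : ℕ, J N + J (N + 1) = B (-N) := by
    intro N
    have h := integral_div_sin_add_integral_div_sin (B := fun s => B (s - N))
      (hBd.comp (by fun_prop)) h0 h1 hδ hδπ (C := C * 2) (fun s hs => by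
        refine (hb _ ?_).trans ?_
        · have : (0 : ℝ) ≤ N := N.cast_nonneg
          simp; linarith [hs.2]
        · have h2 : (2 : ℝ) ^ (s - N).re ≤ 2 := by
            have : (0 : ℝ) ≤ N := N.cast_nonneg
            calc (2 : ℝ) ^ (s - N).re ≤ 2 ^ (1 : ℝ) :=
                  Real.rpow_le_rpow_of_exponent_le (by norm_num) (by simp; linarith [hs.2])
              _ = 2 := Real.rpow_one 2
          have h3 : (s - N).im = s.im := by simp
          rw [h3, mul_right_comm]
          gcongr)
    have e : ∀ τ : ℝ, (σ + τ * Complex.I : ℂ) - 1 - N = σ + τ * Complex.I - ((N + 1 : ℕ) : ℂ) := by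
      intro τ; push_cast; ring
    simp only [e, zero_sub] at h
    simp only [hJ]
    rw [← mul_add, h]
    ring
  have hJ0 : Filter.Tendsto J Filter.atTop (nhds 0) := by
    have hs := sin_pi_mul_pos h0 h1
    set K := ∫ τ : ℝ, Real.exp (-(δ * |τ|)) with hK
    refine squeeze_zero_norm (a := fun N : ℕ =>
      2⁻¹ * (C * 2 ^ σ * (2 / Real.sin (Real.pi * σ)) * K) * (1 / 2) ^ N) (fun N => ?_) ?_
    · have h2 : ‖∫ τ : ℝ, B (σ + τ * Complex.I - N) * S τ‖
          ≤ ∫ τ : ℝ, (C * 2 ^ σ * (2 / Real.sin (Real.pi * σ)) * (1 / 2) ^ N)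
            * Real.exp (-(δ * |τ|)) := by
        refine norm_integral_le_of_norm_le ((integrable_exp_neg_mul_abs hδ).const_mul _)
          (Filter.Eventually.of_forall fun τ => ?_)
        rw [norm_mul]
        have h3 := hb (σ + τ * Complex.I - N) (by
          have : (0 : ℝ) ≤ N := N.cast_nonneg
          simp; linarith)
        have h4 : (σ + τ * Complex.I - N : ℂ).re = σ - N := by simp
        have h5 : (σ + τ * Complex.I - N : ℂ).im = τ := by simp
        rw [h4, h5, Real.rpow_sub (by norm_num), Real.rpow_natCast] at h3
        refine (mul_le_mul h3 (norm_inv_sin_le h0 h1 τ) (norm_nonneg _) (by positivity)).trans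
          (le_of_eq ?_)
        rw [show -(δ * |τ|) = (Real.pi - δ) * |τ| + -(Real.pi * |τ|) by ring, Real.exp_add,
          one_div, inv_pow]
        ring
      rw [integral_const_mul] at h2
      simp only [hJ, norm_mul]
      have h3 : ‖(2⁻¹ : ℂ)‖ = 2⁻¹ := by simp
      rw [h3]
      calc _ ≤ _ := mul_le_mul_of_nonneg_left h2 (by norm_num)
        _ = _ := by rw [← hK]; ring
    · simpa using (tendsto_pow_atTop_nhds_zero_of_lt_one (by norm_num : (0 : ℝ) ≤ 1 / 2)
        (by norm_num)).const_mul (2⁻¹ * (C * 2 ^ σ * (2 / Real.sin (Real.pi * σ)) * K))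
  have hpart : ∀ N : ℕ, ∑ k ∈ Finset.range N, (-1) ^ k * B (-k) = J 0 - (-1) ^ N * J N := by
    intro N
    induction N with
    | zero => simp
    | succ N ih => rw [Finset.sum_range_succ, ih, ← hstep N, pow_succ]; ring
  have hterm : ∀ k : ℕ, (-(Complex.exp (ψ * Complex.I) * x)) ^ k
      / Complex.Gamma ((α * k + 1 : ℝ) : ℂ) = (-1) ^ k * B (-k) := by
    intro k
    have e1 : Complex.exp (-(-(k : ℂ) * (ψ * Complex.I + Real.log x)))
        = (Complex.exp (ψ * Complex.I) * x) ^ k := by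
      rw [neg_mul, neg_neg, Complex.exp_nat_mul, Complex.exp_add, ← Complex.ofReal_exp,
        Real.exp_log hx]
    simp only [hBdef]
    rw [e1, neg_pow, div_eq_mul_inv, mul_assoc]
    congr 4
    push_cast; ring
  have hJ0' : J 0 = ∫ τ : ℝ, mellinDensity α ψ (σ + τ * Complex.I)
      * (x : ℂ) ^ (-(σ + τ * Complex.I : ℂ)) := by
    simp only [hJ]
    rw [← integral_const_mul]
    congr 1
    ext τ
    simp only [hBdef, hS, mellinDensity, Nat.cast_zero, sub_zero]
    rw [Complex.cpow_def_of_ne_zero (by exact_mod_cast hx.ne'), ← Complex.ofReal_log hx.le, mul_add,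
      neg_add, Complex.exp_add]
    rw [show (Real.log x : ℂ) * -(σ + τ * Complex.I) = -((σ + τ * Complex.I) * Real.log x) by ring]
    ring
  simp_rw [hterm]
  have hsum : Summable fun k : ℕ => (-1) ^ k * B (-k) := by
    refine Summable.of_norm_bounded (g := fun k : ℕ => C * (1 / 2) ^ k)
      ((summable_geometric_of_lt_one (by norm_num) (by norm_num)).mul_left C) fun k => ?_
    have h2 := hb (-(k : ℂ)) (by
      have : (0 : ℝ) ≤ k := k.cast_nonneg
      simp; linarith)
    simp only [Complex.neg_re, Complex.natCast_re, Complex.neg_im, Complex.natCast_im, neg_zero,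
      abs_zero, mul_zero, Real.exp_zero, mul_one] at h2
    rw [Real.rpow_neg (by norm_num), Real.rpow_natCast] at h2
    simpa [hBdef] using h2
  rw [← hJ0']
  refine (hsum.hasSum_iff_tendsto_nat).2 ?_
  simp_rw [hpart]
  have h2 : Filter.Tendsto (fun N => (-1 : ℂ) ^ N * J N) Filter.atTop (nhds 0) := by
    rw [tendsto_zero_iff_norm_tendsto_zero] at hJ0 ⊢
    simpa using hJ0
  simpa using tendsto_const_nhds.sub h2

/-! ### The Fourier transform of a complex power of `|x|` -/

theorem integrable_rpow_norm_mul {d : ℕ} (hd : 1 ≤ d) {b : ℝ} (hb0 : 0 ≤ b) (hb : b < d)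
    (φ : 𝓢(EuclideanSpace ℝ (Fin d), ℂ)) :
    Integrable fun x : EuclideanSpace ℝ (Fin d) => ‖x‖ ^ (-b) * ‖φ x‖ := by
  have hmeas : AEStronglyMeasurable (fun x : EuclideanSpace ℝ (Fin d) => ‖x‖ ^ (-b) * ‖φ x‖) := by
    have : Measurable fun x : EuclideanSpace ℝ (Fin d) => ‖x‖ ^ (-b) := by fun_prop
    exact (this.mul φ.continuous.norm.measurable).aestronglyMeasurable
  have hfr : Module.finrank ℝ (EuclideanSpace ℝ (Fin d)) = d := by simp
  obtain ⟨C, hC⟩ : ∃ C, ∀ x, ‖φ x‖ ≤ C := by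
    obtain ⟨C, -, hC⟩ := φ.decay 0 0
    exact ⟨C, fun x => by simpa using hC x⟩
  rw [← integrableOn_univ, ← Set.union_compl_self (Metric.ball (0 : EuclideanSpace ℝ (Fin d)) 1)]
  refine IntegrableOn.union ?_ ?_
  · refine integrableOn_ball_of_norm_le_rpow (C := C) (α := b) (by rw [hfr]; exact hd)
      (by rw [hfr]; exact hb) (Filter.Eventually.of_forall fun x => ?_) hmeas
    rw [norm_mul, norm_norm, Real.norm_eq_abs, abs_of_nonneg (by positivity), mul_comm]
    gcongr
    exact hC x
  · refine Integrable.mono' (φ.integrable.norm.integrableOn) hmeas.restrict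
      ((ae_restrict_iff' Metric.isOpen_ball.measurableSet.compl).2
        (Filter.Eventually.of_forall fun x hx => ?_))
    have hx1 : 1 ≤ ‖x‖ := by simpa using hx
    rw [norm_mul, norm_norm, Real.norm_eq_abs, abs_of_nonneg (by positivity)]
    exact mul_le_of_le_one_left (norm_nonneg _)
      (Real.rpow_le_one_of_one_le_of_nonpos hx1 (by linarith))

theorem ae_ne_zero {d : ℕ} (hd : 1 ≤ d) : ∀ᵐ x : EuclideanSpace ℝ (Fin d), x ≠ 0 := by
  have : Nonempty (Fin d) := ⟨⟨0, hd⟩⟩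
  exact Measure.ae_ne volume 0

theorem norm_ofReal_cpow_norm {d : ℕ} {x : EuclideanSpace ℝ (Fin d)} (hx : x ≠ 0) (a : ℂ) :
    ‖(‖x‖ : ℂ) ^ a‖ = ‖x‖ ^ a.re :=
  Complex.norm_cpow_eq_rpow_re_of_pos (norm_pos_iff.2 hx) a

/-- Integrating Gaussian averages of `φ` against powers of the width produces the integral of `φ`
against a power of `|x|`. -/
theorem mellin_integral_gaussian_mul {d : ℕ} (hd : 1 ≤ d) {a : ℂ} (ha0 : 0 < a.re) (ha : a.re < d)
    (φ : 𝓢(EuclideanSpace ℝ (Fin d), ℂ)) :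
    mellin (fun u : ℝ => ∫ x, Complex.exp (-(Real.pi * u * ‖x‖ ^ 2)) * φ x) (a / 2)
      = Complex.Gammaℝ a * ∫ x, (‖x‖ : ℂ) ^ (-a) * φ x := by
  have hre : (a / 2).re = a.re / 2 := by simp
  have hRint : ∀ x : EuclideanSpace ℝ (Fin d), x ≠ 0 →
      ∫ t in Set.Ioi (0 : ℝ), t ^ (a.re / 2 - 1) * Real.exp (-(Real.pi * ‖x‖ ^ 2 * t))
        = (1 / (Real.pi * ‖x‖ ^ 2)) ^ (a.re / 2) * Real.Gamma (a.re / 2) := fun x hx => by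
    have hx := norm_pos_iff.2 hx
    exact Real.integral_rpow_mul_exp_neg_mul_Ioi (by positivity) (by positivity)
  have hRi : ∀ x : EuclideanSpace ℝ (Fin d), x ≠ 0 →
      IntegrableOn (fun t => t ^ (a.re / 2 - 1) * Real.exp (-(Real.pi * ‖x‖ ^ 2 * t)))
        (Set.Ioi (0 : ℝ)) := fun x hx => by
    refine Integrable.of_integral_ne_zero ?_
    rw [hRint x hx]
    have hx := norm_pos_iff.2 hx
    have := Real.Gamma_pos_of_pos (show 0 < a.re / 2 by positivity)
    positivity
  have hRpow : ∀ x : EuclideanSpace ℝ (Fin d), x ≠ 0 →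
      (1 / (Real.pi * ‖x‖ ^ 2)) ^ (a.re / 2) = Real.pi ^ (-(a.re / 2)) * ‖x‖ ^ (-a.re) := by
    intro x hx
    have hx := norm_pos_iff.2 hx
    rw [one_div, ← Real.rpow_neg_eq_inv_rpow, Real.mul_rpow Real.pi_pos.le (by positivity),
      ← Real.rpow_natCast, ← Real.rpow_mul hx.le]
    congr 2
    push_cast; ring
  set F : ℝ → EuclideanSpace ℝ (Fin d) → ℂ := fun t x =>
    (t : ℂ) ^ (a / 2 - 1) * (Complex.exp (-(Real.pi * t * ‖x‖ ^ 2)) * φ x) with hF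
  have hFn : ∀ t ∈ Set.Ioi (0 : ℝ), ∀ x, ‖F t x‖
      = t ^ (a.re / 2 - 1) * Real.exp (-(Real.pi * ‖x‖ ^ 2 * t)) * ‖φ x‖ := by
    intro t ht x
    rw [hF, norm_mul, norm_mul, Complex.norm_cpow_eq_rpow_re_of_pos ht, Complex.norm_exp, ← mul_assoc]
    congr 3
    · simp
    · rw [← Complex.ofReal_pow, ← Complex.ofReal_mul, ← Complex.ofReal_mul, ← Complex.ofReal_neg,
        Complex.ofReal_re]
      ring
  have hFmeas : Measurable (Function.uncurry F) := by
    have h1 : Measurable fun p : ℝ × EuclideanSpace ℝ (Fin d) => (p.1 : ℂ) ^ (a / 2 - 1) := by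
      fun_prop
    have h2 : Continuous fun p : ℝ × EuclideanSpace ℝ (Fin d) =>
        Complex.exp (-(Real.pi * p.1 * ‖p.2‖ ^ 2)) * φ p.2 := by
      have := φ.continuous
      fun_prop
    exact h1.mul h2.measurable
  have hint : Integrable (Function.uncurry F) ((volume.restrict (Set.Ioi (0 : ℝ))).prod volume) := by
    rw [integrable_prod_iff' hFmeas.aestronglyMeasurable]
    constructor
    · filter_upwards [ae_ne_zero hd] with x hx
      refine Integrable.mono' ((hRi x hx).mul_const ‖φ x‖)
        (hFmeas.comp measurable_prodMk_right).aestronglyMeasurable ?_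
      filter_upwards [self_mem_ae_restrict measurableSet_Ioi] with t ht
      exact (hFn t ht x).le
    · refine ((integrable_rpow_norm_mul hd ha0.le ha φ).const_mul
        (Real.pi ^ (-(a.re / 2)) * Real.Gamma (a.re / 2))).congr ?_
      filter_upwards [ae_ne_zero hd] with x hx
      simp only [Function.uncurry_apply_pair]
      rw [setIntegral_congr_fun (g := fun t => t ^ (a.re / 2 - 1)
        * Real.exp (-(Real.pi * ‖x‖ ^ 2 * t)) * ‖φ x‖) measurableSet_Ioi (fun t ht => hFn t ht x),
        integral_mul_const, hRint x hx, hRpow x hx]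
      ring
  have hmell : mellin (fun u : ℝ => ∫ x, Complex.exp (-(Real.pi * u * ‖x‖ ^ 2)) * φ x) (a / 2)
      = ∫ t in Set.Ioi (0 : ℝ), ∫ x, F t x := by
    rw [mellin]
    refine setIntegral_congr_fun measurableSet_Ioi fun t _ => ?_
    simp only [smul_eq_mul, hF]
    rw [integral_const_mul]
  rw [hmell, integral_integral_swap hint, ← integral_const_mul]
  refine integral_congr_ae ?_
  filter_upwards [ae_ne_zero hd] with x hx
  have hx' := norm_pos_iff.2 hx
  have h1 := Complex.integral_cpow_mul_exp_neg_mul_Ioi (a := a / 2) (r := Real.pi * ‖x‖ ^ 2)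
    (by rw [hre]; positivity) (by positivity)
  have h2 : ∀ t : ℝ, F t x = (t : ℂ) ^ (a / 2 - 1)
      * Complex.exp (-(((Real.pi * ‖x‖ ^ 2 : ℝ) : ℂ) * t)) * φ x := by
    intro t
    simp only [hF]
    rw [← mul_assoc]
    push_cast
    ring_nf
  simp_rw [h2]
  rw [integral_mul_const, h1, Complex.Gammaℝ_def]
  have h3 : (1 / ((Real.pi * ‖x‖ ^ 2 : ℝ) : ℂ)) ^ (a / 2)
      = (Real.pi : ℂ) ^ (-a / 2) * (‖x‖ : ℂ) ^ (-a) := by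
    rw [one_div, ← Complex.ofReal_inv, Complex.cpow_def_of_ne_zero (by
      exact_mod_cast (by positivity)), Complex.cpow_def_of_ne_zero (by
      exact_mod_cast Real.pi_ne_zero), Complex.cpow_def_of_ne_zero (by exact_mod_cast hx'.ne'),
      ← Complex.exp_add, ← Complex.ofReal_log (by positivity), ← Complex.ofReal_log hx'.le,
      ← Complex.ofReal_log Real.pi_pos.le, Real.log_inv, Real.log_mul Real.pi_ne_zero (by positivity),
      Real.log_pow]
    congr 1
    push_cast; ring
  rw [h3]
  ring

/-- The multiplication formula for the Fourier transform, applied to a Gaussian. -/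
theorem integral_gaussian_mul_fourierInv {d : ℕ} {u : ℝ} (hu : 0 < u)
    (φ : 𝓢(EuclideanSpace ℝ (Fin d), ℂ)) :
    ∫ ξ, Complex.exp (-(Real.pi * u * ‖ξ‖ ^ 2)) * (𝓕⁻ φ) ξ
      = (u : ℂ) ^ (-((d : ℂ) / 2)) * ∫ x, Complex.exp (-(Real.pi * (u⁻¹ : ℝ) * ‖x‖ ^ 2)) * φ x := by
  set b : ℂ := ((Real.pi * u⁻¹ : ℝ) : ℂ) with hb
  have hbre : 0 < b.re := by
    rw [hb, Complex.ofReal_re]; have := Real.pi_pos; positivity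
  have hG : Integrable fun v : EuclideanSpace ℝ (Fin d) => Complex.exp (-b * ‖v‖ ^ 2) := by
    simpa using GaussianFourier.integrable_cexp_neg_mul_sq_norm_add hbre 0
      (0 : EuclideanSpace ℝ (Fin d))
  have h := VectorFourier.integral_bilin_fourierIntegral_eq_flip (ContinuousLinearMap.mul ℂ ℂ)
    (L := innerₗ (EuclideanSpace ℝ (Fin d))) (μ := volume) (ν := volume)
    Real.continuous_fourierChar continuous_inner hG (𝓕⁻ φ).integrable
  have hflip : (innerₗ (EuclideanSpace ℝ (Fin d))).flip = innerₗ (EuclideanSpace ℝ (Fin d)) := by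
    ext x y; simp
  rw [hflip] at h
  have hL : VectorFourier.fourierIntegral Real.fourierChar volume
      (innerₗ (EuclideanSpace ℝ (Fin d))) (fun v => Complex.exp (-b * ‖v‖ ^ 2))
      = 𝓕 (fun v : EuclideanSpace ℝ (Fin d) => Complex.exp (-b * ‖v‖ ^ 2)) := rfl
  have hR : VectorFourier.fourierIntegral Real.fourierChar volume
      (innerₗ (EuclideanSpace ℝ (Fin d))) (𝓕⁻ φ : 𝓢(EuclideanSpace ℝ (Fin d), ℂ))
      = (φ : EuclideanSpace ℝ (Fin d) → ℂ) := by
    have : VectorFourier.fourierIntegral Real.fourierChar volume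
      (innerₗ (EuclideanSpace ℝ (Fin d))) (𝓕⁻ φ : 𝓢(EuclideanSpace ℝ (Fin d), ℂ))
      = 𝓕 ((𝓕⁻ φ : 𝓢(EuclideanSpace ℝ (Fin d), ℂ)) : EuclideanSpace ℝ (Fin d) → ℂ) := rfl
    rw [this, ← SchwartzMap.fourier_coe, FourierTransform.fourier_fourierInv_eq]
  rw [hL, hR] at h
  have hpi : (Real.pi : ℂ) ≠ 0 := by exact_mod_cast Real.pi_ne_zero
  have hu' : (u : ℂ) ≠ 0 := by exact_mod_cast hu.ne'
  have h4 : ∀ ξ : EuclideanSpace ℝ (Fin d),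
      𝓕 (fun v : EuclideanSpace ℝ (Fin d) => Complex.exp (-b * ‖v‖ ^ 2)) ξ
        = (u : ℂ) ^ ((d : ℂ) / 2) * Complex.exp (-(Real.pi * u * ‖ξ‖ ^ 2)) := by
    intro ξ
    rw [fourier_gaussian_innerProductSpace hbre]
    congr 2
    · rw [hb]; push_cast; field_simp
    · simp
    · rw [hb]; push_cast; field_simp
  simp only [ContinuousLinearMap.mul_apply', h4, mul_assoc] at h
  rw [integral_const_mul] at h
  rw [Complex.cpow_neg, eq_inv_mul_iff_mul_eq₀ (by simp [Complex.cpow_eq_zero_iff, hu'])]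
  have hb' : ∀ x : EuclideanSpace ℝ (Fin d),
      -((Real.pi : ℂ) * ((u⁻¹ : ℝ) : ℂ) * (‖x‖ : ℂ) ^ 2) = -b * (‖x‖ : ℂ) ^ 2 := by
    intro x; rw [hb]; push_cast; ring
  simp_rw [hb', mul_assoc]
  exact h

/-- The inverse Fourier transform of `|ξ|^{-a}` is `Gammaℝ(d - a) / Gammaℝ(a) · |x|^{a - d}`, as
tempered distributions, for `0 < Re a < d`. -/
theorem integral_cpow_norm_mul_fourierInv {d : ℕ} (hd : 1 ≤ d) {a : ℂ} (ha0 : 0 < a.re)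
    (ha : a.re < d) (φ : 𝓢(EuclideanSpace ℝ (Fin d), ℂ)) :
    ∫ ξ, (‖ξ‖ : ℂ) ^ (-a) * (𝓕⁻ φ) ξ
      = Complex.Gammaℝ (d - a) / Complex.Gammaℝ a * ∫ x, (‖x‖ : ℂ) ^ (a - d) * φ x := by
  have h1 := mellin_integral_gaussian_mul hd ha0 ha (𝓕⁻ φ)
  have h2 := mellin_integral_gaussian_mul hd (a := d - a) (by simpa using ha) (by simpa using ha0) φ
  have h3 : mellin (fun u : ℝ => ∫ x, Complex.exp (-(Real.pi * u * ‖x‖ ^ 2)) * (𝓕⁻ φ) x) (a / 2)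
      = mellin (fun u : ℝ => ∫ x, Complex.exp (-(Real.pi * u * ‖x‖ ^ 2)) * φ x) ((d - a) / 2) := by
    rw [show ((d : ℂ) - a) / 2 = -(a / 2 + -((d : ℂ) / 2)) by ring, ← mellin_comp_inv,
      ← mellin_cpow_smul]
    refine setIntegral_congr_fun measurableSet_Ioi fun t ht => ?_
    simp only
    rw [integral_gaussian_mul_fourierInv ht φ, smul_eq_mul, smul_eq_mul, smul_eq_mul]
  rw [h1, h2, neg_sub] at h3
  have h4 := Complex.Gammaℝ_ne_zero_of_re_pos ha0
  field_simp
  linear_combination h3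

/-! ### Superpositions of powers of `|x|` -/

theorem norm_superposition_le {d : ℕ} {b κ : ℝ} (w : ℝ → ℂ) {x : EuclideanSpace ℝ (Fin d)}
    (hx : x ≠ 0) :
    ‖∫ τ : ℝ, w τ * (‖x‖ : ℂ) ^ (-(b + κ * τ * Complex.I : ℂ))‖ ≤ (∫ τ, ‖w τ‖) * ‖x‖ ^ (-b) := by
  refine (norm_integral_le_integral_norm _).trans (le_of_eq ?_)
  rw [← integral_mul_const]
  congr 1
  ext τ
  rw [norm_mul, norm_ofReal_cpow_norm hx]
  simp

theorem measurable_superposition_integrand {d : ℕ} (b κ : ℝ) {w : ℝ → ℂ} (hw : Measurable w) :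
    Measurable fun p : EuclideanSpace ℝ (Fin d) × ℝ =>
      w p.2 * (‖p.1‖ : ℂ) ^ (-(b + κ * p.2 * Complex.I : ℂ)) := by
  fun_prop

theorem aestronglyMeasurable_superposition {d : ℕ} (b κ : ℝ) {w : ℝ → ℂ} (hw : Measurable w) :
    AEStronglyMeasurable fun x : EuclideanSpace ℝ (Fin d) =>
      ∫ τ : ℝ, w τ * (‖x‖ : ℂ) ^ (-(b + κ * τ * Complex.I : ℂ)) :=
  ((measurable_superposition_integrand b κ hw).stronglyMeasurable.integral_prod_right
    (f := fun (x : EuclideanSpace ℝ (Fin d)) (τ : ℝ) =>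
      w τ * (‖x‖ : ℂ) ^ (-(b + κ * τ * Complex.I : ℂ)))).aestronglyMeasurable

theorem integrable_superposition_mul {d : ℕ} (hd : 1 ≤ d) {b κ : ℝ} (hb0 : 0 ≤ b) (hb : b < d)
    {w : ℝ → ℂ} (hw : Measurable w) (φ : 𝓢(EuclideanSpace ℝ (Fin d), ℂ)) :
    Integrable fun x : EuclideanSpace ℝ (Fin d) =>
      (∫ τ : ℝ, w τ * (‖x‖ : ℂ) ^ (-(b + κ * τ * Complex.I : ℂ))) * φ x := by
  refine ((integrable_rpow_norm_mul hd hb0 hb φ).const_mul (∫ τ, ‖w τ‖)).mono'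
    ((aestronglyMeasurable_superposition b κ hw).mul φ.continuous.aestronglyMeasurable) ?_
  filter_upwards [ae_ne_zero hd] with x hx
  rw [norm_mul, ← mul_assoc]
  gcongr
  exact norm_superposition_le w hx

theorem integral_superposition_mul {d : ℕ} (hd : 1 ≤ d) {b κ : ℝ} (hb0 : 0 ≤ b) (hb : b < d)
    {w : ℝ → ℂ} (hw : Measurable w) (hwi : Integrable w) (φ : 𝓢(EuclideanSpace ℝ (Fin d), ℂ)) :
    ∫ x : EuclideanSpace ℝ (Fin d),
      (∫ τ : ℝ, w τ * (‖x‖ : ℂ) ^ (-(b + κ * τ * Complex.I : ℂ))) * φ x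
      = ∫ τ : ℝ, w τ * ∫ x : EuclideanSpace ℝ (Fin d),
        (‖x‖ : ℂ) ^ (-(b + κ * τ * Complex.I : ℂ)) * φ x := by
  have hm : Measurable fun p : EuclideanSpace ℝ (Fin d) × ℝ =>
      w p.2 * (‖p.1‖ : ℂ) ^ (-(b + κ * p.2 * Complex.I : ℂ)) * φ p.1 :=
    (measurable_superposition_integrand b κ hw).mul (φ.continuous.measurable.comp measurable_fst)
  have hint : Integrable (Function.uncurry fun (x : EuclideanSpace ℝ (Fin d)) (τ : ℝ) =>
      w τ * (‖x‖ : ℂ) ^ (-(b + κ * τ * Complex.I : ℂ)) * φ x) (volume.prod volume) := by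
    refine ((integrable_rpow_norm_mul hd hb0 hb φ).mul_prod hwi.norm).mono'
      hm.aestronglyMeasurable ?_
    have h0 : ∀ᵐ p : EuclideanSpace ℝ (Fin d) × ℝ ∂(volume.prod volume), p.1 ≠ 0 :=
      Measure.quasiMeasurePreserving_fst.ae (ae_ne_zero hd)
    filter_upwards [h0] with p hp
    simp only [Function.uncurry]
    rw [norm_mul, norm_mul, norm_ofReal_cpow_norm hp]
    simp only [Complex.neg_re, Complex.add_re, Complex.ofReal_re, Complex.mul_re, Complex.ofReal_im,
      mul_zero, sub_zero, Complex.I_re, Complex.mul_im, zero_mul, add_zero, Complex.I_im, mul_one,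
      sub_self]
    exact le_of_eq (by ring)
  calc _ = ∫ x : EuclideanSpace ℝ (Fin d), ∫ τ : ℝ,
        w τ * (‖x‖ : ℂ) ^ (-(b + κ * τ * Complex.I : ℂ)) * φ x := by
        congr 1; ext x; rw [integral_mul_const]
    _ = ∫ τ : ℝ, ∫ x : EuclideanSpace ℝ (Fin d),
        w τ * (‖x‖ : ℂ) ^ (-(b + κ * τ * Complex.I : ℂ)) * φ x := integral_integral_swap hint
    _ = _ := by
        congr 1; ext τ
        simp_rw [mul_assoc]
        rw [integral_const_mul]

theorem IsInverseFourier.congr_symbol {d : ℕ} {m m' K : EuclideanSpace ℝ (Fin d) → ℂ}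
    (h : IsInverseFourier m K) (hm : m =ᵐ[volume] m') : IsInverseFourier m' K where
  integrable_symbol φ := (h.integrable_symbol φ).congr (by
    filter_upwards [hm] with ξ hξ; rw [hξ])
  locallyIntegrable := h.locallyIntegrable
  integrable_kernel := h.integrable_kernel
  pairing φ := (h.pairing φ).trans (integral_congr_ae (by
    filter_upwards [hm] with ξ hξ; rw [hξ]))

theorem IsInverseFourier.ae_eq {d : ℕ} {m K K' : EuclideanSpace ℝ (Fin d) → ℂ}
    (h : IsInverseFourier m K) (h' : IsInverseFourier m K') : K =ᵐ[volume] K' := by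
  refine ae_eq_of_integral_contDiff_smul_eq h.locallyIntegrable h'.locallyIntegrable
    fun g hg hgs => ?_
  have hs : HasCompactSupport fun x => (g x : ℂ) := hgs.comp_left (g := Complex.ofReal) (by simp)
  have hc : ContDiff ℝ (⊤ : ℕ∞) fun x => (g x : ℂ) := Complex.ofRealCLM.contDiff.comp hg
  have h1 := (h.pairing (hs.toSchwartzMap hc)).trans (h'.pairing (hs.toSchwartzMap hc)).symm
  simpa [mul_comm] using h1

/-- The constant in the Fourier transform of `|ξ|^{-a}`. -/
noncomputable def rieszConst (d : ℕ) (a : ℂ) : ℂ := Complex.Gammaℝ (d - a) / Complex.Gammaℝ a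

/-- Fourier inversion of a superposition of the powers `|ξ|^{-(b + iκτ)}` can be carried out under
the integral. -/
theorem isInverseFourier_superposition {d : ℕ} (hd : 1 ≤ d) {b κ : ℝ} (hb0 : 0 < b) (hb : b < d)
    {w : ℝ → ℂ} (hw : Measurable w) (hwi : Integrable w)
    (hv : Measurable fun τ : ℝ => w τ * rieszConst d (b + κ * τ * Complex.I))
    (hvi : Integrable fun τ : ℝ => w τ * rieszConst d (b + κ * τ * Complex.I)) :
    IsInverseFourier
      (fun ξ : EuclideanSpace ℝ (Fin d) =>
        ∫ τ : ℝ, w τ * (‖ξ‖ : ℂ) ^ (-(b + κ * τ * Complex.I : ℂ)))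
      (fun x => ∫ τ : ℝ, (w τ * rieszConst d (b + κ * τ * Complex.I))
        * (‖x‖ : ℂ) ^ (-(((d - b : ℝ) : ℂ) + ((-κ : ℝ) : ℂ) * τ * Complex.I))) where
  integrable_symbol φ := integrable_superposition_mul hd hb0.le hb hw φ
  locallyIntegrable := by
    have hfr : Module.finrank ℝ (EuclideanSpace ℝ (Fin d)) = d := by simp
    refine locallyIntegrable_of_norm_le_rpow (α := d - b)
      (C := ∫ τ : ℝ, ‖w τ * rieszConst d (b + κ * τ * Complex.I)‖) (by rw [hfr]; exact hd)
      (by rw [hfr]; linarith) ?_ (aestronglyMeasurable_superposition _ _ hv)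
    filter_upwards [ae_ne_zero hd] with x hx using norm_superposition_le _ hx
  integrable_kernel φ := integrable_superposition_mul hd (by linarith) (by linarith) hv φ
  pairing φ := by
    rw [integral_superposition_mul hd (by linarith) (by linarith) hv hvi φ,
      integral_superposition_mul hd hb0.le hb hw hwi (𝓕⁻ φ)]
    congr 1
    ext τ
    rw [integral_cpow_norm_mul_fourierInv hd (by simpa using hb0) (by simpa using hb), mul_assoc,
      rieszConst]
    congr 5
    ext x
    congr 2
    push_cast; ring

theorem exists_norm_rieszConst_le {d : ℕ} {b ε : ℝ} (hb0 : 0 < b) (hb : b < d) (hε : 0 < ε) :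
    ∃ C : ℝ, 0 < C ∧ ∀ y : ℝ,
      ‖rieszConst d (b + y * Complex.I)‖ ≤ C * Real.exp (ε * |y|) := by
  obtain ⟨C₁, hC₁, h₁⟩ := exists_norm_Gamma_le (a := (d - b) / 2) (by linarith) hε
  obtain ⟨C₂, hC₂, h₂⟩ := exists_norm_inv_Gamma_le hε (zero_lt_one (α := ℝ))
  have hpi := Real.pi_pos
  refine ⟨Real.pi ^ (-(d - b) / 2) * C₁ * ((Real.pi ^ (-b / 2))⁻¹ * C₂), by positivity,
    fun y => ?_⟩
  have e1 : ((d : ℂ) - (b + y * Complex.I)) / 2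
      = (((d - b) / 2 : ℝ) : ℂ) + ((-y / 2 : ℝ) : ℂ) * Complex.I := by push_cast; ring
  have h3 := h₁ (-y / 2)
  have h4 := h₂ ((b + y * Complex.I) / 2) (by simp; linarith)
  have him : ((b + y * Complex.I : ℂ) / 2).im = y / 2 := by simp
  rw [him, Real.one_rpow, mul_one, abs_div, abs_two] at h4
  rw [abs_div, abs_neg, abs_two] at h3
  rw [rieszConst, div_eq_mul_inv, Complex.Gammaℝ_def, Complex.Gammaℝ_def, mul_inv, norm_mul, norm_mul,
    norm_mul, e1, norm_inv, Complex.norm_cpow_eq_rpow_re_of_pos hpi,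
    Complex.norm_cpow_eq_rpow_re_of_pos hpi]
  have e2 : (-((d : ℂ) - (b + y * Complex.I)) / 2).re = -(d - b) / 2 := by simp
  have e3 : (-(b + y * Complex.I : ℂ) / 2).re = -b / 2 := by simp
  rw [e2, e3]
  calc _ ≤ Real.pi ^ (-(d - b) / 2) * (C₁ * Real.exp (-((Real.pi / 2 - ε) * (|y| / 2))))
        * ((Real.pi ^ (-b / 2))⁻¹ * (C₂ * Real.exp ((Real.pi / 2 + ε) * (|y| / 2)))) := by
        gcongr
    _ = _ := by
      rw [show ε * |y| = -((Real.pi / 2 - ε) * (|y| / 2)) + (Real.pi / 2 + ε) * (|y| / 2) by ring,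
        Real.exp_add]
      ring

theorem continuous_rieszConst_line {d : ℕ} {b κ : ℝ} (hb0 : 0 < b) (hb : b < d) :
    Continuous fun τ : ℝ => rieszConst d (b + κ * τ * Complex.I) := by
  have hpi : (Real.pi : ℂ) ≠ 0 := by exact_mod_cast Real.pi_ne_zero
  have hG : ∀ s : ℂ, 0 < s.re → ContinuousAt Complex.Gammaℝ s := by
    intro s hs
    have h1 : ContinuousAt Complex.Gamma (s / 2) :=
      (Complex.differentiableAt_Gamma _ fun m hm => by
        have := congrArg Complex.re hm
        have h2 : (0 : ℝ) ≤ m := m.cast_nonneg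
        simp at this
        linarith).continuousAt
    have h2 : ContinuousAt (fun s : ℂ => Complex.Gamma (s / 2)) s :=
      ContinuousAt.comp (f := fun s : ℂ => s / 2) (g := Complex.Gamma) h1 (by fun_prop)
    have h3 : ContinuousAt (fun s : ℂ => (Real.pi : ℂ) ^ (-s / 2)) s :=
      ContinuousAt.const_cpow (by fun_prop) (Or.inl hpi)
    exact h3.mul h2
  unfold rieszConst
  refine continuous_iff_continuousAt.2 fun τ => ContinuousAt.div ?_ ?_ ?_
  · exact ContinuousAt.comp (f := fun τ : ℝ => (d : ℂ) - (b + κ * τ * Complex.I))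
      (hG _ (by simpa using hb)) (by fun_prop)
  · exact ContinuousAt.comp (f := fun τ : ℝ => (b + κ * τ * Complex.I : ℂ))
      (hG _ (by simpa using hb0)) (by fun_prop)
  · exact Complex.Gammaℝ_ne_zero_of_re_pos (by simpa using hb0)

/-! ### Pointwise bounds for the symbol and for the kernel -/

/-- The condition on `|μ - ν|` places `-e^{(ν-μ)πi}` in the sector where the Mellin–Barnes integral
converges. -/
theorem exists_exp_eq_neg_exp {α μ ν : ℝ} (h1 : α / 2 < |μ - ν|) (h2 : |μ - ν| < 2 - α / 2) :
    ∃ ψ : ℝ, |ψ| < Real.pi - α / 2 * Real.pi ∧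
      Complex.exp (((ν - μ) * Real.pi : ℝ) * Complex.I) = -Complex.exp (ψ * Complex.I) := by
  have hpi := Real.pi_pos
  rcases le_total 0 (μ - ν) with h | h
  · rw [abs_of_nonneg h] at h1 h2
    refine ⟨(ν - μ + 1) * Real.pi, ?_, ?_⟩
    · rw [abs_mul, abs_of_pos hpi, ← one_sub_mul]
      refine mul_lt_mul_of_pos_right (abs_lt.2 ⟨?_, ?_⟩) hpi <;> linarith
    · rw [show (((ν - μ + 1) * Real.pi : ℝ) : ℂ) * Complex.I
        = (((ν - μ) * Real.pi : ℝ) : ℂ) * Complex.I + Real.pi * Complex.I by push_cast; ring,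
        Complex.exp_add, Complex.exp_pi_mul_I]
      ring
  · rw [abs_of_nonpos h] at h1 h2
    refine ⟨(ν - μ - 1) * Real.pi, ?_, ?_⟩
    · rw [abs_mul, abs_of_pos hpi, ← one_sub_mul]
      refine mul_lt_mul_of_pos_right (abs_lt.2 ⟨?_, ?_⟩) hpi <;> linarith
    · rw [show (((ν - μ - 1) * Real.pi : ℝ) : ℂ) * Complex.I
        = (((ν - μ) * Real.pi : ℝ) : ℂ) * Complex.I - Real.pi * Complex.I by push_cast; ring,
        Complex.exp_sub, Complex.exp_pi_mul_I]
      ring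

theorem ofReal_rpow_mul_rpow_cpow {t y α β : ℝ} (ht : 0 < t) (hy : 0 < y) (s : ℂ) :
    ((t ^ α * y ^ β : ℝ) : ℂ) ^ s = (t : ℂ) ^ (α * s) * (y : ℂ) ^ (β * s) := by
  rw [Complex.cpow_def_of_ne_zero (by exact_mod_cast (by positivity)),
    Complex.cpow_def_of_ne_zero (by exact_mod_cast ht.ne'),
    Complex.cpow_def_of_ne_zero (by exact_mod_cast hy.ne'), ← Complex.exp_add,
    ← Complex.ofReal_log (by positivity), ← Complex.ofReal_log ht.le, ← Complex.ofReal_log hy.le,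
    Real.log_mul (by positivity) (by positivity), Real.log_rpow ht, Real.log_rpow hy]
  congr 1
  push_cast; ring

/-- The symbol is a superposition of the powers `|ξ|^{-β(σ + iτ)}`. -/
theorem solutionSymbol_eq_integral {d : ℕ} {α β μ ν ψ σ t : ℝ} (hα : 0 < α) (hα2 : α < 2)
    (hψ : |ψ| < Real.pi - α / 2 * Real.pi)
    (hω : Complex.exp (((ν - μ) * Real.pi : ℝ) * Complex.I) = -Complex.exp (ψ * Complex.I))
    (h0 : 0 < σ) (h1 : σ < 1) (ht : 0 < t) {ξ : EuclideanSpace ℝ (Fin d)} (hξ : ξ ≠ 0) :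
    solutionSymbol α β μ ν t ξ = ∫ τ : ℝ,
      (mellinDensity α ψ (σ + τ * Complex.I) * (t : ℂ) ^ (-(α * (σ + τ * Complex.I) : ℂ)))
        * (‖ξ‖ : ℂ) ^ (-(((β * σ : ℝ) : ℂ) + β * τ * Complex.I)) := by
  have hξ' := norm_pos_iff.2 hξ
  have h := hasSum_mittagLeffler hα hα2 hψ h0 h1 (x := t ^ α * ‖ξ‖ ^ β) (by positivity)
  rw [solutionSymbol, hω, mittagLeffler, neg_mul, h.tsum_eq]
  congr 1
  ext τ
  rw [ofReal_rpow_mul_rpow_cpow ht hξ', mul_assoc]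
  congr 3
  · ring
  · push_cast; ring

theorem norm_mellinDensity_mul_cpow {α ψ σ t τ : ℝ} (ht : 0 < t) :
    ‖mellinDensity α ψ (σ + τ * Complex.I) * (t : ℂ) ^ (-(α * (σ + τ * Complex.I) : ℂ))‖
      = t ^ (-(α * σ)) * ‖mellinDensity α ψ (σ + τ * Complex.I)‖ := by
  rw [norm_mul, Complex.norm_cpow_eq_rpow_re_of_pos ht, mul_comm]
  simp

theorem continuous_mellinDensity_mul_cpow (α ψ : ℝ) {σ t : ℝ} (h0 : 0 < σ) (h1 : σ < 1)
    (ht : 0 < t) : Continuous fun τ : ℝ =>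
      mellinDensity α ψ (σ + τ * Complex.I) * (t : ℂ) ^ (-(α * (σ + τ * Complex.I) : ℂ)) :=
  (continuous_mellinDensity_line α ψ h0 h1).mul
    (Continuous.const_cpow (by fun_prop) (Or.inl (by exact_mod_cast ht.ne')))

theorem exists_norm_solutionSymbol_le (d : ℕ) {α β μ ν σ : ℝ} (hα : 0 < α) (hα2 : α < 2)
    (hμν : α / 2 < |μ - ν|) (hμν2 : |μ - ν| < 2 - α / 2) (h0 : 0 < σ) (h1 : σ < 1) :
    ∃ C : ℝ, 0 ≤ C ∧ ∀ t : ℝ, 0 < t → ∀ ξ : EuclideanSpace ℝ (Fin d), ξ ≠ 0 →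
      ‖solutionSymbol α β μ ν t ξ‖ ≤ C * t ^ (-(α * σ)) * ‖ξ‖ ^ (-(β * σ)) := by
  obtain ⟨ψ, hψ, hω⟩ := exists_exp_eq_neg_exp hμν hμν2
  refine ⟨∫ τ : ℝ, ‖mellinDensity α ψ (σ + τ * Complex.I)‖,
    integral_nonneg fun _ => norm_nonneg _, fun t ht ξ hξ => ?_⟩
  rw [solutionSymbol_eq_integral hα hα2 hψ hω h0 h1 ht hξ]
  refine (norm_superposition_le _ hξ).trans (le_of_eq ?_)
  simp_rw [norm_mellinDensity_mul_cpow ht]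
  rw [integral_const_mul]
  ring

theorem aestronglyMeasurable_solutionSymbol {d : ℕ} (hd : 1 ≤ d) {α β μ ν t : ℝ} (hα : 0 < α)
    (hα2 : α < 2) (hμν : α / 2 < |μ - ν|) (hμν2 : |μ - ν| < 2 - α / 2) (ht : 0 < t) :
    AEStronglyMeasurable (solutionSymbol (d := d) α β μ ν t) := by
  obtain ⟨ψ, hψ, hω⟩ := exists_exp_eq_neg_exp hμν hμν2
  have h0 : (0 : ℝ) < 1 / 2 := by norm_num
  have h1 : (1 / 2 : ℝ) < 1 := by norm_num
  refine (aestronglyMeasurable_superposition (β * (1 / 2)) β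
    (continuous_mellinDensity_mul_cpow α ψ h0 h1 ht).measurable).congr ?_
  filter_upwards [ae_ne_zero hd] with ξ hξ
  rw [solutionSymbol_eq_integral hα hα2 hψ hω h0 h1 ht hξ]

/-- Every line `Re s = σ` with `0 < σ < 1` and `βσ < d` yields a kernel, with its own power
bound. -/
theorem exists_isInverseFourier_norm_le {d : ℕ} (hd : 1 ≤ d) {α β μ ν σ : ℝ} (hα : 0 < α)
    (hα2 : α < 2) (hβ : 0 < β) (hμν : α / 2 < |μ - ν|) (hμν2 : |μ - ν| < 2 - α / 2) (h0 : 0 < σ)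
    (h1 : σ < 1) (hσd : β * σ < d) :
    ∃ C : ℝ, 0 ≤ C ∧ ∀ t : ℝ, 0 < t → ∃ V : EuclideanSpace ℝ (Fin d) → ℂ,
      IsInverseFourier (solutionSymbol α β μ ν t) V ∧
      ∀ x, x ≠ 0 → ‖V x‖ ≤ C * t ^ (-(α * σ)) * ‖x‖ ^ (-(d - β * σ)) := by
  obtain ⟨ψ, hψ, hω⟩ := exists_exp_eq_neg_exp hμν hμν2
  obtain ⟨C₁, δ, hC₁, hδ, hΦ⟩ := exists_norm_mellinDensity_le hα hα2 hψ h0 h1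
  have hb0 : 0 < β * σ := by positivity
  obtain ⟨C₂, hC₂, hR⟩ := exists_norm_rieszConst_le (d := d) (b := β * σ) (ε := δ / (2 * β)) hb0 hσd
    (by positivity)
  have hRc := continuous_rieszConst_line (κ := β) hb0 hσd
  have hR' : ∀ τ : ℝ, ‖rieszConst d (((β * σ : ℝ) : ℂ) + β * τ * Complex.I)‖
      ≤ C₂ * Real.exp (δ / 2 * |τ|) := by
    intro τ
    have := hR (β * τ)
    rw [abs_mul, abs_of_pos hβ, ← mul_assoc, show δ / (2 * β) * β = δ / 2 by field_simp] at this
    push_cast at this ⊢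
    exact this
  set I := ∫ τ : ℝ, ‖mellinDensity α ψ (σ + τ * Complex.I)
    * rieszConst d (((β * σ : ℝ) : ℂ) + β * τ * Complex.I)‖ with hI
  refine ⟨I, integral_nonneg fun _ => norm_nonneg _, fun t ht => ?_⟩
  set w : ℝ → ℂ := fun τ =>
    mellinDensity α ψ (σ + τ * Complex.I) * (t : ℂ) ^ (-(α * (σ + τ * Complex.I) : ℂ)) with hw
  have hwc : Continuous w := continuous_mellinDensity_mul_cpow α ψ h0 h1 ht
  have hwn : ∀ τ, ‖w τ‖ = t ^ (-(α * σ)) * ‖mellinDensity α ψ (σ + τ * Complex.I)‖ := fun τ =>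
    norm_mellinDensity_mul_cpow ht
  have hwi : Integrable w := by
    refine integrable_of_norm_le_exp_neg_mul_abs (C := t ^ (-(α * σ)) * C₁) hwc hδ fun τ => ?_
    rw [hwn, mul_assoc]
    gcongr
    exact hΦ τ
  have hvc : Continuous fun τ : ℝ => w τ * rieszConst d (((β * σ : ℝ) : ℂ) + β * τ * Complex.I) :=
    hwc.mul hRc
  have hvi : Integrable fun τ : ℝ =>
      w τ * rieszConst d (((β * σ : ℝ) : ℂ) + β * τ * Complex.I) := by
    refine integrable_of_norm_le_exp_neg_mul_abs (C := t ^ (-(α * σ)) * C₁ * C₂) (δ := δ / 2) hvc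
      (by positivity) fun τ => ?_
    rw [norm_mul, hwn]
    calc _ ≤ t ^ (-(α * σ)) * (C₁ * Real.exp (-(δ * |τ|))) * (C₂ * Real.exp (δ / 2 * |τ|)) := by
          gcongr
          · exact hΦ τ
          · exact hR' τ
      _ = _ := by
        rw [show -(δ / 2 * |τ|) = -(δ * |τ|) + δ / 2 * |τ| by ring, Real.exp_add]
        ring
  refine ⟨_, (isInverseFourier_superposition hd hb0 hσd hwc.measurable hwi hvc.measurable
    hvi).congr_symbol ?_, fun x hx => ?_⟩
  · filter_upwards [ae_ne_zero hd] with ξ hξ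
    rw [solutionSymbol_eq_integral hα hα2 hψ hω h0 h1 ht hξ]
  · refine (norm_superposition_le _ hx).trans (le_of_eq ?_)
    congr 1
    rw [mul_comm I, hI, ← integral_const_mul]
    congr 1
    ext τ
    rw [norm_mul, hwn, norm_mul, mul_assoc]

/-! ### Young's convolution inequality -/

section Young

variable {G : Type*} [AddCommGroup G] [MeasurableSpace G] [MeasurableAdd₂ G] [MeasurableNeg G]
  {μ : Measure G} [SFinite μ] [μ.IsAddLeftInvariant] [μ.IsNegInvariant]

/-- Young's convolution inequality for nonnegative functions and a finite target exponent, by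
Hölder's inequality for three functions applied to
`u v = (u ^ r v ^ p) ^ (1/q) (u ^ r) ^ (1/r - 1/q) (v ^ p) ^ (1/p - 1/q)`. -/
theorem lintegral_rpow_lintegral_mul_sub_le {u v : G → ℝ≥0∞} (hu : AEMeasurable u μ)
    (hv : AEMeasurable v μ) {p q r : ℝ} (hp : 1 ≤ p) (hr : 1 ≤ r) (hq : 0 < q)
    (hpqr : 1 / p + 1 / r = 1 + 1 / q) :
    ∫⁻ x, (∫⁻ y, u y * v (x - y) ∂μ) ^ q ∂μ
      ≤ (∫⁻ y, u y ^ r ∂μ) ^ (q / r) * (∫⁻ y, v y ^ p ∂μ) ^ (q / p) := by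
  have hp0 : 0 < p := by linarith
  have hr0 : 0 < r := by linarith
  have h1p : 1 / p ≤ 1 := by rw [div_le_one hp0]; exact hp
  have h1r : 1 / r ≤ 1 := by rw [div_le_one hr0]; exact hr
  have hκ0 : 0 ≤ 1 / q := by positivity
  have hκ1 : 0 ≤ 1 / r - 1 / q := by linarith
  have hκ2 : 0 ≤ 1 / p - 1 / q := by linarith
  set U := ∫⁻ y, u y ^ r ∂μ with hU
  set W := ∫⁻ y, v y ^ p ∂μ with hW
  have hvx : ∀ x, AEMeasurable (fun y => v (x - y)) μ := fun x =>
    hv.comp_quasiMeasurePreserving (Measure.measurePreserving_sub_left μ x).quasiMeasurePreserving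
  have hWx : ∀ x, ∫⁻ y, v (x - y) ^ p ∂μ = W := fun x =>
    lintegral_sub_left_eq_self (fun y => v y ^ p) x
  have hpt : ∀ a b : ℝ≥0∞, (a ^ r * b ^ p) ^ (1 / q) * (a ^ r) ^ (1 / r - 1 / q)
      * (b ^ p) ^ (1 / p - 1 / q) = a * b := by
    intro a b
    have e1 : a ^ (r * (1 / q)) * a ^ (r * (1 / r - 1 / q)) = a := by
      rw [← ENNReal.rpow_add_of_nonneg _ _ (by positivity) (mul_nonneg hr0.le hκ1), ← mul_add,
        add_sub_cancel, mul_one_div_cancel hr0.ne', ENNReal.rpow_one]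
    have e2 : b ^ (p * (1 / q)) * b ^ (p * (1 / p - 1 / q)) = b := by
      rw [← ENNReal.rpow_add_of_nonneg _ _ (by positivity) (mul_nonneg hp0.le hκ2), ← mul_add,
        add_sub_cancel, mul_one_div_cancel hp0.ne', ENNReal.rpow_one]
    rw [ENNReal.mul_rpow_of_nonneg _ _ hκ0, ← ENNReal.rpow_mul, ← ENNReal.rpow_mul,
      ← ENNReal.rpow_mul, ← ENNReal.rpow_mul]
    calc _ = (a ^ (r * (1 / q)) * a ^ (r * (1 / r - 1 / q)))
          * (b ^ (p * (1 / q)) * b ^ (p * (1 / p - 1 / q))) := by ring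
      _ = a * b := by rw [e1, e2]
  have hx : ∀ x, ∫⁻ y, u y * v (x - y) ∂μ
      ≤ (∫⁻ y, u y ^ r * v (x - y) ^ p ∂μ) ^ (1 / q) * U ^ (1 / r - 1 / q)
        * W ^ (1 / p - 1 / q) := by
    intro x
    have h := ENNReal.lintegral_prod_norm_pow_le (μ := μ) (Finset.univ : Finset (Fin 3))
      (f := ![fun y => u y ^ r * v (x - y) ^ p, fun y => u y ^ r, fun y => v (x - y) ^ p])
      (p := ![1 / q, 1 / r - 1 / q, 1 / p - 1 / q])
      (by
        intro i _
        fin_cases i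
        · exact (hu.pow_const r).mul ((hvx x).pow_const p)
        · exact hu.pow_const r
        · exact (hvx x).pow_const p)
      (by simp only [Fin.sum_univ_three, Matrix.cons_val]; linarith)
      (by
        intro i _
        fin_cases i
        · exact hκ0
        · exact hκ1
        · exact hκ2)
    simp only [Fin.prod_univ_three, Matrix.cons_val, hpt] at h
    rw [hWx x] at h
    exact h
  have hton : ∫⁻ x, ∫⁻ y, u y ^ r * v (x - y) ^ p ∂μ ∂μ = U * W := by
    rw [lintegral_lintegral_swap]
    · have hy : ∀ y, ∫⁻ x, u y ^ r * v (x - y) ^ p ∂μ = u y ^ r * W := by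
        intro y
        rw [lintegral_const_mul'', lintegral_sub_right_eq_self (fun x => v x ^ p) y]
        exact (hv.comp_quasiMeasurePreserving
          (measurePreserving_sub_right μ y).quasiMeasurePreserving).pow_const p
      simp_rw [hy]
      rw [lintegral_mul_const'' _ (hu.pow_const r)]
    · refine AEMeasurable.mul ((hu.comp_quasiMeasurePreserving
        Measure.quasiMeasurePreserving_snd).pow_const r) (AEMeasurable.pow_const ?_ p)
      exact hv.comp_quasiMeasurePreserving (quasiMeasurePreserving_sub_of_right_invariant μ μ)
  calc ∫⁻ x, (∫⁻ y, u y * v (x - y) ∂μ) ^ q ∂μ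
      ≤ ∫⁻ x, (∫⁻ y, u y ^ r * v (x - y) ^ p ∂μ)
          * (U ^ (q * (1 / r - 1 / q)) * W ^ (q * (1 / p - 1 / q))) ∂μ := by
        refine lintegral_mono fun x => ?_
        refine (ENNReal.rpow_le_rpow (hx x) hq.le).trans (le_of_eq ?_)
        rw [ENNReal.mul_rpow_of_nonneg _ _ hq.le, ENNReal.mul_rpow_of_nonneg _ _ hq.le,
          ← ENNReal.rpow_mul, ← ENNReal.rpow_mul, ← ENNReal.rpow_mul, one_div_mul_cancel hq.ne',
          ENNReal.rpow_one, mul_assoc, mul_comm q, mul_comm q]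
    _ = U * W * (U ^ (q * (1 / r - 1 / q)) * W ^ (q * (1 / p - 1 / q))) := by
        rw [lintegral_mul_const'', hton]
        have hm : AEMeasurable (fun z : G × G => u z.2 ^ r * v (z.1 - z.2) ^ p) (μ.prod μ) :=
          AEMeasurable.mul ((hu.comp_quasiMeasurePreserving
            Measure.quasiMeasurePreserving_snd).pow_const r) (AEMeasurable.pow_const
            (hv.comp_quasiMeasurePreserving
              (quasiMeasurePreserving_sub_of_right_invariant μ μ)) p)
        exact hm.lintegral_prod_right'
    _ = (U * U ^ (q * (1 / r - 1 / q))) * (W * W ^ (q * (1 / p - 1 / q))) := by ring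
    _ = U ^ (q / r) * W ^ (q / p) := by
        congr 1
        · nth_rewrite 1 [← ENNReal.rpow_one U]
          rw [← ENNReal.rpow_add_of_nonneg _ _ zero_le_one (mul_nonneg hq.le hκ1)]
          congr 1
          field_simp
          ring
        · nth_rewrite 1 [← ENNReal.rpow_one W]
          rw [← ENNReal.rpow_add_of_nonneg _ _ zero_le_one (mul_nonneg hq.le hκ2)]
          congr 1
          field_simp
          ring

end Young

theorem conv_apply_eq {d : ℕ} (K f : EuclideanSpace ℝ (Fin d) → ℂ) (x : EuclideanSpace ℝ (Fin d)) :
    conv K f x = ∫ y, K y * f (x - y) := rfl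

theorem aestronglyMeasurable_conv {d : ℕ} {K f : EuclideanSpace ℝ (Fin d) → ℂ}
    (hK : AEStronglyMeasurable K) (hf : AEStronglyMeasurable f) :
    AEStronglyMeasurable (conv K f) :=
  (hK.convolution_integrand (ContinuousLinearMap.mul ℂ ℂ) hf).integral_prod_right'

theorem aestronglyMeasurable_mul_sub {d : ℕ} {K f : EuclideanSpace ℝ (Fin d) → ℂ}
    (hK : AEStronglyMeasurable K) (hf : AEStronglyMeasurable f) (x : EuclideanSpace ℝ (Fin d)) :
    AEStronglyMeasurable fun y => K y * f (x - y) :=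
  hK.convolution_integrand_snd (ContinuousLinearMap.mul ℂ ℂ) hf x

theorem enorm_conv_le {d : ℕ} (K f : EuclideanSpace ℝ (Fin d) → ℂ) (x : EuclideanSpace ℝ (Fin d)) :
    ‖conv K f x‖ₑ ≤ ∫⁻ y, ‖K y‖ₑ * ‖f (x - y)‖ₑ := by
  rw [conv_apply_eq]
  refine (enorm_integral_le_lintegral_enorm _).trans (le_of_eq ?_)
  simp_rw [enorm_mul]

theorem convExistsAt_of_lintegral_lt_top {d : ℕ} {K f : EuclideanSpace ℝ (Fin d) → ℂ}
    (hK : AEStronglyMeasurable K) (hf : AEStronglyMeasurable f) {x : EuclideanSpace ℝ (Fin d)}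
    (h : ∫⁻ y, ‖K y‖ₑ * ‖f (x - y)‖ₑ < ∞) : ConvExistsAt K f x := by
  refine ⟨aestronglyMeasurable_mul_sub hK hf x, ?_⟩
  rw [hasFiniteIntegral_iff_enorm]
  simpa [enorm_mul] using h

theorem young_convolution_of_ne_top {d : ℕ} {p q r : ℝ≥0∞} (hp : 1 ≤ p) (hr : 1 ≤ r) (hpt : p ≠ ∞)
    (hrt : r ≠ ∞) (hq0 : q ≠ 0) (hqt : q ≠ ∞)
    (hpqr : 1 / p.toReal + 1 / r.toReal = 1 + 1 / q.toReal)
    {K f : EuclideanSpace ℝ (Fin d) → ℂ} (hK : MemLp K r) (hf : MemLp f p) :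
    (∀ᵐ x, ConvExistsAt K f x) ∧
      eLpNorm (conv K f) q volume ≤ eLpNorm K r volume * eLpNorm f p volume := by
  have hp0 : p ≠ 0 := (zero_lt_one.trans_le hp).ne'
  have hr0 : r ≠ 0 := (zero_lt_one.trans_le hr).ne'
  have hp1 : 1 ≤ p.toReal := by
    rw [← ENNReal.toReal_one]; exact ENNReal.toReal_mono hpt hp
  have hr1 : 1 ≤ r.toReal := by
    rw [← ENNReal.toReal_one]; exact ENNReal.toReal_mono hrt hr
  have hq1 : 0 < q.toReal := ENNReal.toReal_pos hq0 hqt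
  have key := lintegral_rpow_lintegral_mul_sub_le (μ := (volume : Measure (EuclideanSpace ℝ (Fin d))))
    hK.1.enorm hf.1.enorm hp1 hr1 hq1 hpqr
  have hUW : (∫⁻ y, ‖K y‖ₑ ^ r.toReal) ^ (q.toReal / r.toReal)
      * (∫⁻ y, ‖f y‖ₑ ^ p.toReal) ^ (q.toReal / p.toReal)
      = (eLpNorm K r volume * eLpNorm f p volume) ^ q.toReal := by
    rw [ENNReal.mul_rpow_of_nonneg _ _ hq1.le, eLpNorm_eq_lintegral_rpow_enorm_toReal hr0 hrt,
      eLpNorm_eq_lintegral_rpow_enorm_toReal hp0 hpt, ← ENNReal.rpow_mul, ← ENNReal.rpow_mul]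
    congr 2 <;> ring
  rw [hUW] at key
  have hfin : (eLpNorm K r volume * eLpNorm f p volume) ^ q.toReal < ∞ :=
    ENNReal.rpow_lt_top_of_nonneg hq1.le (ENNReal.mul_lt_top hK.2 hf.2).ne
  have hm : AEMeasurable fun x => (∫⁻ y, ‖K y‖ₑ * ‖f (x - y)‖ₑ) ^ q.toReal := by
    refine AEMeasurable.pow_const ?_ _
    have := (hK.1.convolution_integrand (ContinuousLinearMap.mul ℂ ℂ)
      (μ := (volume : Measure (EuclideanSpace ℝ (Fin d)))) hf.1).enorm.lintegral_prod_right'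
    simpa [enorm_mul] using this
  refine ⟨?_, ?_⟩
  · filter_upwards [ae_lt_top' hm (key.trans_lt hfin).ne] with x hx
    refine convExistsAt_of_lintegral_lt_top hK.1 hf.1 ?_
    exact (ENNReal.rpow_lt_top_iff_of_pos hq1).1 hx
  · rw [eLpNorm_eq_lintegral_rpow_enorm_toReal hq0 hqt, one_div]
    refine (ENNReal.rpow_inv_le_iff hq1).2 (le_trans (lintegral_mono fun x => ?_) key)
    exact ENNReal.rpow_le_rpow (enorm_conv_le K f x) hq1.le

theorem young_convolution_top {d : ℕ} {p r : ℝ≥0∞} (hpr : r⁻¹ + p⁻¹ = 1)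
    {K f : EuclideanSpace ℝ (Fin d) → ℂ} (hK : MemLp K r) (hf : MemLp f p) :
    (∀ᵐ x, ConvExistsAt K f x) ∧
      eLpNorm (conv K f) ∞ volume ≤ eLpNorm K r volume * eLpNorm f p volume := by
  have : ENNReal.HolderTriple r p 1 := ⟨by rw [hpr, inv_one]⟩
  have hx : ∀ x, ∫⁻ y, ‖K y‖ₑ * ‖f (x - y)‖ₑ ≤ eLpNorm K r volume * eLpNorm f p volume := by
    intro x
    have hmp := Measure.measurePreserving_sub_left
      (volume : Measure (EuclideanSpace ℝ (Fin d))) x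
    have h := eLpNorm_smul_le_mul_eLpNorm (hf.comp_measurePreserving hmp).1 hK.1 (p := r) (q := p)
      (r := 1)
    rw [eLpNorm_comp_measurePreserving hf.1 hmp, eLpNorm_one_eq_lintegral_enorm] at h
    simpa [enorm_mul] using h
  refine ⟨Filter.Eventually.of_forall fun x => ?_, ?_⟩
  · exact convExistsAt_of_lintegral_lt_top hK.1 hf.1
      ((hx x).trans_lt (ENNReal.mul_lt_top hK.2 hf.2))
  · rw [eLpNorm_exponent_top]
    exact eLpNormEssSup_le_of_ae_enorm_bound
      (Filter.Eventually.of_forall fun x => (enorm_conv_le K f x).trans (hx x))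

/-! ### Scale-invariant `L ^ r` bounds -/

theorem memLp_two_powers {d : ℕ} (hd : 1 ≤ d) {a b r : ℝ} (hr : 0 < r) (ha : a * r < d)
    (hb : d < b * r) :
    MemLp (fun y : EuclideanSpace ℝ (Fin d) => if ‖y‖ < 1 then ‖y‖ ^ (-a) else ‖y‖ ^ (-b))
      (ENNReal.ofReal r) volume := by
  have hfr : Module.finrank ℝ (EuclideanSpace ℝ (Fin d)) = d := by simp
  set g : EuclideanSpace ℝ (Fin d) → ℝ := fun y => if ‖y‖ < 1 then ‖y‖ ^ (-a) else ‖y‖ ^ (-b)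
    with hg
  have hgm : Measurable g :=
    Measurable.ite (measurableSet_lt (by fun_prop) (by fun_prop)) (by fun_prop) (by fun_prop)
  have hg0 : ∀ y, 0 ≤ g y := fun y => by
    simp only [hg]; split_ifs <;> positivity
  rw [← integrable_norm_rpow_iff hgm.aestronglyMeasurable (by simpa using hr) ENNReal.ofReal_ne_top,
    ENNReal.toReal_ofReal hr.le]
  have hm : AEStronglyMeasurable (fun y => ‖g y‖ ^ r) :=
    (hgm.norm.pow_const r).aestronglyMeasurable
  rw [← integrableOn_univ, ← Set.union_compl_self (Metric.ball (0 : EuclideanSpace ℝ (Fin d)) 1)]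
  refine IntegrableOn.union ?_ ?_
  · refine integrableOn_ball_of_norm_le_rpow (C := 1) (α := a * r) (by rw [hfr]; exact hd)
      (by rw [hfr]; exact ha) ((ae_restrict_iff' Metric.isOpen_ball.measurableSet).2
        (Filter.Eventually.of_forall fun x hx => ?_)) hm
    have hx1 : ‖x‖ < 1 := by simpa using hx
    rw [Real.norm_eq_abs, abs_of_nonneg (by positivity), Real.norm_eq_abs, abs_of_nonneg (hg0 x)]
    simp only [hg, hx1, if_true]
    rw [← Real.rpow_mul (norm_nonneg _), one_mul, neg_mul]
  · have hi := (integrable_one_add_norm (E := EuclideanSpace ℝ (Fin d)) (μ := volume) (r := b * r)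
      (by rw [hfr]; exact hb)).const_mul (2 ^ (b * r))
    refine Integrable.mono' hi.integrableOn hm.restrict
      ((ae_restrict_iff' Metric.isOpen_ball.measurableSet.compl).2
        (Filter.Eventually.of_forall fun x hx => ?_))
    have hx1 : 1 ≤ ‖x‖ := by simpa using hx
    have hbr : 0 ≤ b * r := (Nat.cast_nonneg d).trans hb.le
    rw [Real.norm_eq_abs, abs_of_nonneg (by positivity), Real.norm_eq_abs, abs_of_nonneg (hg0 x)]
    simp only [hg, not_lt.2 hx1, if_false]
    rw [← Real.rpow_mul (norm_nonneg _), neg_mul, Real.rpow_neg (by positivity),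
      Real.rpow_neg (by positivity), ← div_eq_mul_inv, ← Real.inv_rpow (by positivity),
      ← Real.div_rpow (by positivity) (by positivity)]
    refine Real.rpow_le_rpow (by positivity) ?_ hbr
    rw [inv_eq_one_div, div_le_div_iff₀ (by positivity) (by positivity)]
    linarith

/-- A function bounded by two powers of `|x|`, one on each side of the critical power `-d / r`, is
in `L ^ r`; the bound scales with dilations. -/
theorem exists_eLpNorm_le_of_two_powers {d : ℕ} (hd : 1 ≤ d) {a b r : ℝ} (hr : 0 < r)
    (ha : a * r < d) (hb : d < b * r) :
    ∃ K : ℝ≥0, ∀ (F : EuclideanSpace ℝ (Fin d) → ℂ) (A l : ℝ), 0 ≤ A → 0 < l →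
      (∀ᵐ x, ‖F x‖ ≤ A * (l * ‖x‖) ^ (-a)) → (∀ᵐ x, ‖F x‖ ≤ A * (l * ‖x‖) ^ (-b)) →
      eLpNorm F (ENNReal.ofReal r) volume
        ≤ K * ENNReal.ofReal (A * l ^ (-(d / r))) := by
  have hfr : Module.finrank ℝ (EuclideanSpace ℝ (Fin d)) = d := by simp
  have hmem := memLp_two_powers hd hr ha hb
  set g : EuclideanSpace ℝ (Fin d) → ℝ := fun y => if ‖y‖ < 1 then ‖y‖ ^ (-a) else ‖y‖ ^ (-b)
    with hg
  refine ⟨(eLpNorm g (ENNReal.ofReal r) volume).toNNReal, fun F A l hA hl h1 h2 => ?_⟩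
  rw [ENNReal.coe_toNNReal hmem.2.ne]
  have hF : ∀ᵐ x, ‖F x‖ ≤ A * ‖(g ∘ fun x => l • x) x‖ := by
    filter_upwards [h1, h2] with x h1 h2
    have hn : ‖l • x‖ = l * ‖x‖ := by rw [norm_smul, Real.norm_eq_abs, abs_of_pos hl]
    refine le_trans ?_ (mul_le_mul_of_nonneg_left (le_abs_self _) hA)
    simp only [hg, Function.comp, hn]
    split_ifs
    · exact h1
    · exact h2
  have hscale : eLpNorm (g ∘ fun x => l • x) (ENNReal.ofReal r) volume
      = ENNReal.ofReal (l ^ (-(d / r))) * eLpNorm g (ENNReal.ofReal r) volume := by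
    have hmap := Measure.map_addHaar_smul (volume : Measure (EuclideanSpace ℝ (Fin d))) hl.ne'
    have hgm : AEStronglyMeasurable g
        (Measure.map (fun x : EuclideanSpace ℝ (Fin d) => l • x) volume) := by
      rw [hmap]
      exact hmem.1.mono_ac Measure.smul_absolutelyContinuous
    rw [← eLpNorm_map_measure hgm (by fun_prop), hmap,
      eLpNorm_smul_measure_of_ne_top ENNReal.ofReal_ne_top, hfr, smul_eq_mul]
    congr 1
    rw [one_div, ENNReal.toReal_inv, ENNReal.toReal_ofReal hr.le,
      ENNReal.ofReal_rpow_of_nonneg (abs_nonneg _) (by positivity),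
      abs_of_pos (by positivity), Real.inv_rpow (by positivity), ← Real.rpow_natCast,
      ← Real.rpow_mul hl.le, ← Real.rpow_neg hl.le]
    rfl
  calc _ ≤ ENNReal.ofReal A * eLpNorm (g ∘ fun x => l • x) (ENNReal.ofReal r) volume :=
        eLpNorm_le_mul_eLpNorm_of_ae_le_mul hF _
    _ = _ := by
        rw [hscale, ENNReal.ofReal_mul hA]
        ring

/-! ### The kernel in `L ^ r` -/

/-- For every admissible `σ`, every kernel with the given symbol obeys the corresponding power
bound, because inverse Fourier transforms are unique almost everywhere. -/
theorem exists_ae_norm_kernel_le {d : ℕ} (hd : 1 ≤ d) {α β μ ν σ : ℝ} (hα : 0 < α)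
    (hα2 : α < 2) (hβ : 0 < β) (hμν : α / 2 < |μ - ν|) (hμν2 : |μ - ν| < 2 - α / 2) (h0 : 0 < σ)
    (h1 : σ < 1) (hσd : β * σ < d) :
    ∃ C : ℝ, 0 ≤ C ∧ ∀ t : ℝ, 0 < t → ∀ V : EuclideanSpace ℝ (Fin d) → ℂ,
      IsInverseFourier (solutionSymbol α β μ ν t) V →
      ∀ᵐ x, ‖V x‖ ≤ C * t ^ (-(α * σ)) * ‖x‖ ^ (-(d - β * σ)) := by
  obtain ⟨C, hC, h⟩ := exists_isInverseFourier_norm_le hd hα hα2 hβ hμν hμν2 h0 h1 hσd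
  refine ⟨C, hC, fun t ht V hV => ?_⟩
  obtain ⟨V', hV', hb⟩ := h t ht
  filter_upwards [hV.ae_eq hV', ae_ne_zero hd] with x hx hx0
  rw [hx]
  exact hb x hx0

theorem exists_eLpNorm_kernel_le {d : ℕ} (hd : 1 ≤ d) {α β μ ν δ : ℝ} (hα : 0 < α)
    (hα2 : α < 2) (hβ : 0 < β) (hμν : α / 2 < |μ - ν|) (hμν2 : |μ - ν| < 2 - α / 2) (hδ0 : 0 < δ)
    (hδ1 : δ < 1) (hδ : δ < β / d) :
    ∃ C : ℝ≥0, ∀ t : ℝ, 0 < t → ∀ V : EuclideanSpace ℝ (Fin d) → ℂ,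
      IsInverseFourier (solutionSymbol α β μ ν t) V →
      eLpNorm V (ENNReal.ofReal (1 / (1 - δ))) volume
        ≤ C * ENNReal.ofReal (t ^ (-(α / β * d * δ))) := by
  have hd0 : (0 : ℝ) < d := by exact_mod_cast hd
  have hr : 0 < 1 - δ := by linarith
  -- the power of `|x|` attached to the line `Re s = δd/β` is critical for this exponent
  have hc1 : δ * d / β < 1 := by
    rw [div_lt_one hβ]; exact (lt_div_iff₀ hd0).1 hδ
  have hc2 : δ * d / β < d / β := by
    gcongr; nlinarith
  have hc0 : 0 < δ * d / β := by positivity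
  obtain ⟨σ₂, hσ₂, hσ₂'⟩ := exists_between (lt_min hc1 hc2)
  have hσ₂1 : σ₂ < 1 := hσ₂'.trans_le (min_le_left _ _)
  have hσ₂d : β * σ₂ < d := by
    have := hσ₂'.trans_le (min_le_right _ _)
    rw [lt_div_iff₀ hβ] at this; linarith
  have hσ₂c : δ * d < β * σ₂ := by rw [div_lt_iff₀ hβ] at hσ₂; linarith
  obtain ⟨σ₁, hσ₁, hσ₁'⟩ := exists_between hc0
  have hσ₁c : β * σ₁ < δ * d := by rw [lt_div_iff₀ hβ] at hσ₁'; linarith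
  obtain ⟨C₁, hC₁, hb₁⟩ := exists_ae_norm_kernel_le hd hα hα2 hβ hμν hμν2 hσ₁ (hσ₁'.trans hc1)
    (by nlinarith)
  obtain ⟨C₂, hC₂, hb₂⟩ := exists_ae_norm_kernel_le hd hα hα2 hβ hμν hμν2 (hc0.trans hσ₂) hσ₂1 hσ₂d
  obtain ⟨K, hK⟩ := exists_eLpNorm_le_of_two_powers hd (a := d - β * σ₂) (b := d - β * σ₁)
    (r := 1 / (1 - δ)) (by positivity) (by rw [mul_one_div, div_lt_iff₀ hr]; nlinarith)
    (by rw [mul_one_div, lt_div_iff₀ hr]; nlinarith)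
  refine ⟨K * (max C₁ C₂).toNNReal, fun t ht V hV => ?_⟩
  have hC : 0 ≤ max C₁ C₂ := hC₁.trans (le_max_left _ _)
  have hconv : ∀ (C σ : ℝ) (x : EuclideanSpace ℝ (Fin d)), C ≤ max C₁ C₂ →
      ‖V x‖ ≤ C * t ^ (-(α * σ)) * ‖x‖ ^ (-(d - β * σ)) →
      ‖V x‖ ≤ max C₁ C₂ * t ^ (-(α * d / β)) * (t ^ (-(α / β)) * ‖x‖) ^ (-(d - β * σ)) := by
    intro C σ x hCm h
    refine h.trans ?_
    rw [Real.mul_rpow (by positivity) (norm_nonneg _), ← Real.rpow_mul ht.le, ← mul_assoc,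
      mul_assoc (max C₁ C₂), ← Real.rpow_add ht]
    have e : -(α * d / β) + -(α / β) * -(d - β * σ) = -(α * σ) := by field_simp; ring
    rw [e]
    gcongr
  have h := hK V (max C₁ C₂ * t ^ (-(α * d / β))) (t ^ (-(α / β))) (by positivity) (by positivity)
    (by filter_upwards [hb₂ t ht V hV] with x hx using hconv C₂ σ₂ x (le_max_right _ _) hx)
    (by filter_upwards [hb₁ t ht V hV] with x hx using hconv C₁ σ₁ x (le_max_left _ _) hx)
  refine h.trans (le_of_eq ?_)
  rw [← Real.rpow_mul ht.le, mul_assoc (max C₁ C₂), ← Real.rpow_add ht, ENNReal.ofReal_mul hC,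
    ENNReal.coe_mul, mul_assoc]
  congr 4
  field_simp
  ring

/-- The inverse Fourier transform of an integrable symbol is given by the Fourier integral. -/
theorem isInverseFourier_of_integrable {d : ℕ} {m : EuclideanSpace ℝ (Fin d) → ℂ}
    (hm : Integrable m) : IsInverseFourier m (𝓕⁻ m) := by
  have hLc : Continuous fun p : EuclideanSpace ℝ (Fin d) × EuclideanSpace ℝ (Fin d) =>
      (-innerₗ (EuclideanSpace ℝ (Fin d))) p.1 p.2 := by
    simp only [LinearMap.neg_apply, innerₗ_apply_apply]
    fun_prop
  have hcont : Continuous (𝓕⁻ m) :=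
    VectorFourier.fourierIntegral_continuous Real.continuous_fourierChar hLc hm
  have hbd : ∀ x, ‖(𝓕⁻ m) x‖ ≤ ∫ ξ, ‖m ξ‖ := fun x =>
    VectorFourier.norm_fourierIntegral_le_integral_norm _ _ _ _ _
  refine ⟨fun φ => ?_, hcont.locallyIntegrable, fun φ => ?_, fun φ => ?_⟩
  · obtain ⟨C, -, hC⟩ := φ.decay 0 0
    exact hm.mul_bdd (c := C) φ.continuous.aestronglyMeasurable
      (Filter.Eventually.of_forall fun x => by simpa using hC x)
  · exact φ.integrable.bdd_mul hcont.aestronglyMeasurable (Filter.Eventually.of_forall hbd)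
  · have h := VectorFourier.integral_bilin_fourierIntegral_eq_flip (ContinuousLinearMap.mul ℂ ℂ)
      (L := -innerₗ (EuclideanSpace ℝ (Fin d))) (μ := volume) (ν := volume)
      Real.continuous_fourierChar hLc hm φ.integrable
    have hflip : (-innerₗ (EuclideanSpace ℝ (Fin d))).flip
        = -innerₗ (EuclideanSpace ℝ (Fin d)) := by
      ext x y; simp [real_inner_comm]
    rw [hflip] at h
    rw [SchwartzMap.fourierInv_coe]
    exact h

/-- When `d < β` the symbol is integrable and its `L¹` norm bounds the kernel uniformly. -/
theorem exists_eLpNorm_top_kernel_le {d : ℕ} (hd : 1 ≤ d) {α β μ ν : ℝ} (hα : 0 < α)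
    (hα2 : α < 2) (hβ : 0 < β) (hμν : α / 2 < |μ - ν|) (hμν2 : |μ - ν| < 2 - α / 2)
    (hβd : 1 < β / d) :
    ∃ C : ℝ≥0, ∀ t : ℝ, 0 < t → ∀ V : EuclideanSpace ℝ (Fin d) → ℂ,
      IsInverseFourier (solutionSymbol α β μ ν t) V →
      eLpNorm V ∞ volume ≤ C * ENNReal.ofReal (t ^ (-(α / β * d * 1))) := by
  have hd0 : (0 : ℝ) < d := by exact_mod_cast hd
  have hc1 : d / β < 1 := by
    rw [div_lt_one hβ]; rwa [one_lt_div hd0] at hβd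
  have hc0 : 0 < d / β := by positivity
  obtain ⟨σ₂, hσ₂, hσ₂'⟩ := exists_between hc1
  obtain ⟨σ₁, hσ₁, hσ₁'⟩ := exists_between hc0
  obtain ⟨C₁, hC₁, hb₁⟩ := exists_norm_solutionSymbol_le (β := β) d hα hα2 hμν hμν2 hσ₁
    (hσ₁'.trans hc1)
  obtain ⟨C₂, hC₂, hb₂⟩ := exists_norm_solutionSymbol_le (β := β) d hα hα2 hμν hμν2
    (hc0.trans hσ₂) hσ₂'
  obtain ⟨K, hK⟩ := exists_eLpNorm_le_of_two_powers hd (a := β * σ₁) (b := β * σ₂) (r := 1)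
    one_pos (by rw [lt_div_iff₀ hβ] at hσ₁'; linarith) (by rw [div_lt_iff₀ hβ] at hσ₂; linarith)
  refine ⟨K * (max C₁ C₂).toNNReal, fun t ht V hV => ?_⟩
  have hC : 0 ≤ max C₁ C₂ := hC₁.trans (le_max_left _ _)
  set m : EuclideanSpace ℝ (Fin d) → ℂ := solutionSymbol α β μ ν t with hmdef
  have hconv : ∀ (C σ : ℝ) (ξ : EuclideanSpace ℝ (Fin d)), C ≤ max C₁ C₂ →
      ‖m ξ‖ ≤ C * t ^ (-(α * σ)) * ‖ξ‖ ^ (-(β * σ)) →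
      ‖m ξ‖ ≤ max C₁ C₂ * (t ^ (α / β) * ‖ξ‖) ^ (-(β * σ)) := by
    intro C σ ξ hCm h
    refine h.trans ?_
    rw [Real.mul_rpow (by positivity) (norm_nonneg _), ← Real.rpow_mul ht.le, ← mul_assoc]
    have e : α / β * -(β * σ) = -(α * σ) := by field_simp
    rw [e]
    gcongr
  have h := hK m (max C₁ C₂) (t ^ (α / β)) hC (by positivity)
    (by filter_upwards [ae_ne_zero hd] with ξ hξ using
      hconv C₁ σ₁ ξ (le_max_left _ _) (hb₁ t ht ξ hξ))
    (by filter_upwards [ae_ne_zero hd] with ξ hξ using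
      hconv C₂ σ₂ ξ (le_max_right _ _) (hb₂ t ht ξ hξ))
  rw [ENNReal.ofReal_one] at h
  have hmi : Integrable m := by
    rw [← memLp_one_iff_integrable]
    exact ⟨aestronglyMeasurable_solutionSymbol hd hα hα2 hμν hμν2 ht,
      h.trans_lt (ENNReal.mul_lt_top ENNReal.coe_lt_top ENNReal.ofReal_lt_top)⟩
  rw [eLpNorm_congr_ae (hV.ae_eq (isInverseFourier_of_integrable hmi)), eLpNorm_exponent_top]
  have hsup : eLpNormEssSup (𝓕⁻ m) volume ≤ eLpNorm m 1 volume := by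
    refine eLpNormEssSup_le_of_ae_enorm_bound (Filter.Eventually.of_forall fun x => ?_)
    rw [eLpNorm_one_eq_lintegral_enorm, ← ofReal_integral_norm_eq_lintegral_enorm hmi,
      ← ofReal_norm]
    exact ENNReal.ofReal_le_ofReal
      (VectorFourier.norm_fourierIntegral_le_integral_norm _ _ _ _ _)
  refine (hsup.trans h).trans (le_of_eq ?_)
  rw [← Real.rpow_mul ht.le, ENNReal.ofReal_mul hC, ENNReal.coe_mul, mul_assoc]
  congr 4
  field_simp

/-- The two preceding bounds in one statement: the exponent `r` with `1 / r = 1 - δ`. -/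
theorem exists_eLpNorm_kernel_le_of_le_one {d : ℕ} (hd : 1 ≤ d) {α β μ ν δ : ℝ} (hα : 0 < α)
    (hα2 : α < 2) (hβ : 0 < β) (hμν : α / 2 < |μ - ν|) (hμν2 : |μ - ν| < 2 - α / 2) (hδ0 : 0 < δ)
    (hδ1 : δ ≤ 1) (hδ : δ < β / d) :
    ∃ r : ℝ≥0∞, 1 ≤ r ∧ r⁻¹ = ENNReal.ofReal (1 - δ) ∧
    ∃ C : ℝ≥0, ∀ t : ℝ, 0 < t → ∀ V : EuclideanSpace ℝ (Fin d) → ℂ,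
      IsInverseFourier (solutionSymbol α β μ ν t) V →
      eLpNorm V r volume ≤ C * ENNReal.ofReal (t ^ (-(α / β * d * δ))) := by
  rcases hδ1.lt_or_eq with h | rfl
  · have h1 : 0 < 1 - δ := by linarith
    refine ⟨_, ?_, ?_, exists_eLpNorm_kernel_le hd hα hα2 hβ hμν hμν2 hδ0 h hδ⟩
    · rw [ENNReal.one_le_ofReal, le_div_iff₀ h1]
      linarith
    · rw [← ENNReal.ofReal_inv_of_pos (by positivity), one_div, inv_inv]
  · exact ⟨∞, le_top, by simp, exists_eLpNorm_top_kernel_le hd hα hα2 hβ hμν hμν2 hδ⟩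

/-! ### Existence of the kernel and the `L ^ p`–`L ^ q` estimate -/

theorem theorem4 (d : ℕ) (hd : 1 ≤ d) (α β μ ν : ℝ)
    (hα : 0 < α) (hα2 : α < 2) (hβ : 0 < β)
    (hμ : μ ∈ Set.Ioc (-1 : ℝ) 1) (hν : ν ∈ Set.Ioc (-1 : ℝ) 1)
    (hμν : α / 2 < |μ - ν|) (hμν2 : |μ - ν| < 2 - α / 2) :
    (∀ t : ℝ, 0 < t → ∃ V : EuclideanSpace ℝ (Fin d) → ℂ,
        IsInverseFourier (solutionSymbol α β μ ν t) V) ∧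
    ∀ p q : ℝ≥0∞, 1 ≤ p → p < q →
      (p⁻¹).toReal - (q⁻¹).toReal < β / d →
      ∃ C : ℝ≥0, ∀ t : ℝ, 0 < t →
        ∀ V : EuclideanSpace ℝ (Fin d) → ℂ,
          IsInverseFourier (solutionSymbol α β μ ν t) V →
          ∀ f : EuclideanSpace ℝ (Fin d) → ℂ, MemLp f p volume →
            (∀ᵐ x : EuclideanSpace ℝ (Fin d), ConvExistsAt V f x) ∧
            MemLp (conv V f) q volume ∧
            eLpNorm (conv V f) q volume ≤
              C * ENNReal.ofReal
                  (t ^ (-(α / β * d * ((p⁻¹).toReal - (q⁻¹).toReal)))) *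
                eLpNorm f p volume := by
  have hd0 : (0 : ℝ) < d := by exact_mod_cast hd
  constructor
  · intro t ht
    obtain ⟨σ, hσ, hσ'⟩ := exists_between (lt_min one_pos (div_pos hd0 hβ))
    have hσd : β * σ < d := by
      have := hσ'.trans_le (min_le_right _ _)
      rw [lt_div_iff₀ hβ] at this; linarith
    obtain ⟨C, -, h⟩ := exists_isInverseFourier_norm_le hd hα hα2 hβ hμν hμν2 hσ
      (hσ'.trans_le (min_le_left _ _)) hσd
    obtain ⟨V, hV, -⟩ := h t ht
    exact ⟨V, hV⟩
  · intro p q hp hpq hlt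
    set δ := (p⁻¹).toReal - (q⁻¹).toReal with hδdef
    have hp0 : p ≠ 0 := (zero_lt_one.trans_le hp).ne'
    have hpt : p ≠ ∞ := hpq.ne_top
    have hpi : p⁻¹ ≠ ∞ := ENNReal.inv_ne_top.2 hp0
    have hp1 : (p⁻¹).toReal ≤ 1 := by
      rw [← ENNReal.toReal_one]
      exact ENNReal.toReal_mono ENNReal.one_ne_top (ENNReal.inv_le_one.2 hp)
    have hδ0 : 0 < δ := by
      have : (q⁻¹).toReal < (p⁻¹).toReal :=
        ENNReal.toReal_strict_mono hpi (ENNReal.inv_lt_inv.2 hpq)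
      linarith
    have hδ1 : δ ≤ 1 := by
      have : 0 ≤ (q⁻¹).toReal := ENNReal.toReal_nonneg
      linarith
    obtain ⟨r, hr1, hrδ, C, hC⟩ := exists_eLpNorm_kernel_le_of_le_one hd hα hα2 hβ hμν hμν2 hδ0
      hδ1 hlt
    refine ⟨C, fun t ht V hV f hf => ?_⟩
    have hVb := hC t ht V hV
    have hVm : MemLp V r volume := ⟨hV.locallyIntegrable.aestronglyMeasurable,
      hVb.trans_lt (ENNReal.mul_lt_top ENNReal.coe_lt_top ENNReal.ofReal_lt_top)⟩
    have hY : (∀ᵐ x, ConvExistsAt V f x) ∧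
        eLpNorm (conv V f) q volume ≤ eLpNorm V r volume * eLpNorm f p volume := by
      rcases eq_or_ne q ∞ with rfl | hqt
      · refine young_convolution_top ?_ hVm hf
        have hδp : δ = (p⁻¹).toReal := by simp [hδdef]
        rw [hrδ, hδp, ← ENNReal.ofReal_toReal hpi, ENNReal.toReal_ofReal ENNReal.toReal_nonneg,
          ← ENNReal.ofReal_add (by linarith) ENNReal.toReal_nonneg, sub_add_cancel,
          ENNReal.ofReal_one]
      · have hq0 : q ≠ 0 := (bot_le.trans_lt hpq).ne'
        have hqp : 0 < (q⁻¹).toReal :=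
          ENNReal.toReal_pos (ENNReal.inv_ne_zero.2 hqt) (ENNReal.inv_ne_top.2 hq0)
        have hδ1' : 0 < 1 - δ := by linarith
        have hrt : r ≠ ∞ := by
          rintro rfl
          rw [ENNReal.inv_top] at hrδ
          exact (ENNReal.ofReal_pos.2 hδ1').ne hrδ
        refine young_convolution_of_ne_top hp hr1 hpt hrt hq0 hqt ?_ hVm hf
        rw [one_div, one_div, one_div, ← ENNReal.toReal_inv, ← ENNReal.toReal_inv,
          ← ENNReal.toReal_inv, hrδ, ENNReal.toReal_ofReal hδ1'.le]
        linarith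
    have hfinal : eLpNorm (conv V f) q volume
        ≤ C * ENNReal.ofReal (t ^ (-(α / β * d * δ))) * eLpNorm f p volume :=
      hY.2.trans (mul_le_mul_left hVb _)
    exact ⟨hY.1, ⟨aestronglyMeasurable_conv hVm.1 hf.1, hfinal.trans_lt (ENNReal.mul_lt_top
      (ENNReal.mul_lt_top ENNReal.coe_lt_top ENNReal.ofReal_lt_top) hf.2)⟩, hfinal⟩
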